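/- **System.** Let $\dot x=Ax+Bu$, $A\in\mathbb R^{n_x\times n_x}$, $B\in\mathbb R^{n_x\times n_u}$, $x(0)$ arbitrary, and let $K$ be such that all eigenvalues of $A+BK$ have negative real part. Let $S$ be invertible with $SAS^{-1}=\mathrm{diag}(A_1,\dots,A_p)$ in real Jordan form: $A_r$ is the Jordan block of order $n_r$ of a real eigenvalue $c_r$ (put $d_r=0$), or the real Jordan block of order $2n_r$ of a pair $c_r\pm d_r i$, $d_r\ne0$, with diagonal cells $\begin{pmatrix}c_r&-d_r\\ d_r&c_r\end{pmatrix}$ and identity cells above the diagonal. Let $E(t)=\mathrm{diag}(E_1(t),\dots,E_p(t))$ with $E_r(t)=I$ if $d_r=0$, and $E_r(t)$ block diagonal with cells $\begin{pmatrix}\cos d_rt&\sin d_rt\\-\sin d_rt&\cos d_rt\end{pmatrix}$ if $d_r\neq0$. Put $\bar x(t)=E(t)Sx(t)$, $\bar B(t)=E(t)SB$, $\bar K(t)=KS^{-1}E(t)^{-1}$ and $\bar A=\mathrm{diag}(\bar A_1,\dots,\bar A_p)$, where $\bar A_r$ is the Jordan block of order $n_r$ with eigenvalue $c_r$ if $d_r=0$,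 and the Kronecker product of that block with the $2\times2$ identity if $d_r\ne0$. **Network.** Transmissions are attempted at $t_k=k\Delta$, $k\ge0$, $\Delta>0$. A DoS signal is a finite or infinite sequence of successive, non-overlapping intervals $H_n=\{h_n\}\cup[h_n,h_n+\tau_n[$, $h_n,\tau_n\ge0$. For given $\eta,\kappa\ge0$, $\tau_D>0$, $T>1$ it is assumed that, for all $0\le\tau\le t$, the number of $h_n$ in $[\tau,t]$ is at most $\eta+\frac{t-\tau}{\tau_D}$, and $\bigcup_nH_n\cap[\tau,t]$ has length at most $\kappa+\frac{t-\tau}{T}$. The attempt at $t_k$ succeeds iff $t_k\notin\bigcup_nH_n$; $z_0<z_1<\cdots$ are the instants of success. For $a\leq b$ let $T_S(a,b)$ be the number of successes in $]a,b]$, and $T_S(a,b^-)$ the number in $]a,b[$. **Bits.** For each $r$ let $R_r\ge0$ be an integer and $w_r$ a real number with $w_r>c_r$. Put $s_0^r=z_0$ and $$s_g^r=\min\Big\{z_m>s_{g-1}^r:\ \tfrac{e^{c_r(z_m-s_{g-1}^r)}}{(2^{R_r})^{T_S(s_{g-1}^r,z_m)}}<1\Big\}\quad(g\ge1).$$ At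 an attempt $t_k\in\,]s_{g-1}^r,s_g^r]$ each element of the $r$-th block uses $$R_r(t_k)=\begin{cases}\min\{\max\{0,\lceil w_r(t_k-s_{g-1}^r)\log_2e\rceil\},R_r\}&\text{if } \frac{e^{c_r(t_k-s_{g-1}^r)}}{(2^{R_r})^{T_S(s_{g-1}^r,t_k^-)+1}}<1,\\ R_r&\text{otherwise}\end{cases}$$ bits. For $t_k\le z_0$ the numbers of bits $R_r(t_k)\in\{0,1,2,\dots\}$ are arbitrary. **Closed loop.** For $\chi\in[-1,1]$ let $q_0(\chi)=0$ and, for $R\ge1$, $q_R(\chi)=\big(\lfloor2^{R-1}\chi\rfloor+\tfrac12\big)/2^{R-1}$ if $\chi<1$, $q_R(1)=1-\tfrac12/2^{R-1}$. The input is $u(t)=\bar K(t)\hat x(t)$. The predictor $\hat x$ and the quantization range $J=(j_l)$ satisfy $\dot{\hat x}=\bar A\hat x+\bar B(t)u$, $\dot J=\bar AJ$ for $t\ne z_m$, and at $t=z_m$, for every $l$ belonging to block $r$, $$\hat x_l(t)=\hat x_l(t^-)-j_l(t^-)\,q_{R_r(t)}\Big(\tfrac{\hat x_l(t^-)-\bar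 x_l(t)}{j_l(t^-)}\Big),\qquad j_l(t)=2^{-R_r(t)}j_l(t^-),$$ with $\hat x(0^-)=0$ and $j_l(0^-)>|\bar x_l(0)|$ for all $l$. **Theorem.** Suppose $\frac1T+\frac{\Delta}{\tau_D}<1$ and, for every $r$ with $c_r\ge0$, $$R_r>\frac{1}{1-\frac1T-\frac{\Delta}{\tau_D}}\,c_r\,\Delta\log_2e .$$ Then the closed-loop system is exponentially stable: there are constants $C,\delta>0$, depending only on $A,B,K,S$, the chosen Jordan form, $\Delta,\eta,\tau_D,\kappa,T,(R_r),(w_r)$, such that for every DoS signal as above and every trajectory of the closed loop, $$\max\{\|x(t)\|,\|\hat x(t)\|,\|J(t)\|\}\le C\,e^{-\delta t}\,\big(\|x(0)\|+\|J(0^-)\|\big)\qquad\text{for all }t\ge0 .$$ -/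

import Mathlib

open Filter Topology MeasureTheory
open scoped Matrix Kronecker

noncomputable section

namespace QuantizedDoS

/-! ### Denial-of-Service signals -/

/-- A Denial-of-Service signal with `N ≤ ∞` attacks. The `n`-th attack starts (off/on transition)
at `h n ≥ 0` and lasts `τ n ≥ 0`; the attacks are ordered in time and do not overlap.
The values `h n`, `τ n` with `n ≥ N` are irrelevant. -/
structure DoS where
  N : ℕ∞
  h : ℕ → ℝ
  τ : ℕ → ℝ
  h_nonneg : ∀ n : ℕ, (n : ℕ∞) < N → 0 ≤ h n
  τ_nonneg : ∀ n : ℕ, (n : ℕ∞) < N → 0 ≤ τ n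
  h_lt : ∀ n : ℕ, ((n + 1 : ℕ) : ℕ∞) < N → h n < h (n + 1)
  h_add_le : ∀ n : ℕ, ((n + 1 : ℕ) : ℕ∞) < N → h n + τ n ≤ h (n + 1)

namespace DoS

variable (dos : DoS)

/-- The `n`-th DoS interval `{h_n} ∪ [h_n, h_n + τ_n[`. -/
def interval (n : ℕ) : Set ℝ := {dos.h n} ∪ Set.Ico (dos.h n) (dos.h n + dos.τ n)

/-- The set of all times at which the network is in DoS status. -/
def active : Set ℝ := {t | ∃ n : ℕ, (n : ℕ∞) < dos.N ∧ t ∈ dos.interval n}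

/-- The (indices of the) off/on transitions over `[a, b]`. -/
def transitions (a b : ℝ) : Set ℕ := {n | (n : ℕ∞) < dos.N ∧ dos.h n ∈ Set.Icc a b}

/-- DoS frequency: over every `[a, b]` there are at most `η + (b - a) / τ_D` transitions. -/
def FrequencyBound (η τD : ℝ) : Prop :=
  ∀ a b : ℝ, 0 ≤ a → a ≤ b →
    (dos.transitions a b).Finite ∧ ((dos.transitions a b).ncard : ℝ) ≤ η + (b - a) / τD

/-- DoS duration: over every `[a, b]` the DoS status has total length at most
`κ + (b - a) / T`. -/
def DurationBound (κ T : ℝ) : Prop :=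
  ∀ a b : ℝ, 0 ≤ a → a ≤ b →
    volume (dos.active ∩ Set.Icc a b) ≤ ENNReal.ofReal (κ + (b - a) / T)

/-- Transmission attempts take place at `t_k = k Δ`. Attempt `k` succeeds iff the network is not
in DoS status at `t_k`. -/
def Success (Δ : ℝ) (k : ℕ) : Prop := (k : ℝ) * Δ ∉ dos.active

end DoS

/-! ### Bit-computing part -/

/-- `e^{c (t_k - t_a)} / (2^R)^m`. -/
def decayRatio (Δ c : ℝ) (R a k m : ℕ) : ℝ :=
  Real.exp (c * ((k : ℝ) * Δ - (a : ℝ) * Δ)) / ((2 : ℝ) ^ R) ^ m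

/-- The index of the attempt that takes place at the instant `s_g`: `s_0` is the first successful
transmission instant `z_0`, and `s_{g+1}` is the smallest successful transmission instant
`z_m > s_g` with `e^{c (z_m - s_g)} / (2^R)^{T_S(s_g, z_m)} < 1`, where `T_S(s_g, z_m)` is the
number of successful transmissions in `]s_g, z_m]`. -/
def syncAttempt (dos : DoS) (Δ c : ℝ) (R : ℕ) : ℕ → ℕ
  | 0 => sInf {k | dos.Success Δ k}
  | g + 1 => sInf {k | syncAttempt dos Δ c R g < k ∧ dos.Success Δ k ∧
      decayRatio Δ c R (syncAttempt dos Δ c R g) k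
        {j | syncAttempt dos Δ c R g < j ∧ j ≤ k ∧ dos.Success Δ j}.ncard < 1}

/-- The number of bits determined right before attempt `k`, when the last synchronization instant
is `s = t_a`: `min {⌈w (t_k - s) log₂ e⌉, R}` if `e^{c (t_k - s)} / (2^R)^{T_S(s, t_k⁻) + 1} < 1`,
and `R` otherwise. A number of bits is a natural number, so a negative value of the
ceiling (possible only for `w < 0`) counts as `0`. -/
def bitRule (dos : DoS) (Δ c w : ℝ) (R a k : ℕ) : ℕ :=
  open Classical in
  if decayRatio Δ c R a k ({j | a < j ∧ j < k ∧ dos.Success Δ j}.ncard + 1) < 1 then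
    min ⌈w * ((k : ℝ) * Δ - (a : ℝ) * Δ) * Real.logb 2 (Real.exp 1)⌉₊ R
  else R

/-- `bits r k`, the number of bits per element of the `r`-th block at attempt `k`, follows the
time-varying bit-rate protocol. Nothing is prescribed up to and including `z_0 = s_0`. -/
def FollowsBitProtocol {p : ℕ} (dos : DoS) (Δ : ℝ) (c w : Fin p → ℝ) (R : Fin p → ℕ)
    (bits : Fin p → ℕ → ℕ) : Prop :=
  ∀ (r : Fin p) (g k : ℕ),
    syncAttempt dos Δ (c r) (R r) g < k → k ≤ syncAttempt dos Δ (c r) (R r) (g + 1) →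
      bits r k = bitRule dos Δ (c r) (w r) (R r) (syncAttempt dos Δ (c r) (R r) g) k

/-! ### The uniform quantizer -/

/-- The uniform quantizer with `R` bits; for `R ≥ 1` it is saturated to the right of `1`
(the relevant arguments lie in `[-1, 1]`). -/
def quantizer (R : ℕ) (χ : ℝ) : ℝ :=
  if R = 0 then 0
  else if χ < 1 then ((⌊(2 : ℝ) ^ (R - 1) * χ⌋ : ℝ) + 0.5) / (2 : ℝ) ^ (R - 1)
  else 1 - 0.5 / (2 : ℝ) ^ (R - 1)

/-! ### Real Jordan form and the second transformation -/

/-- The shape of a real Jordan form with `p` blocks. Block `r` belongs to the real eigenvalue `c r`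
if `d r = 0`, and to the pair `c r ± (d r) i` if `d r ≠ 0`; its order is `n r`
resp. `2 * n r`. -/
structure JordanShape (p : ℕ) where
  c : Fin p → ℝ
  d : Fin p → ℝ
  n : Fin p → ℕ
  n_pos : ∀ r, 0 < n r

namespace JordanShape

variable {p : ℕ} (F : JordanShape p)

/-- The size of the small diagonal cells of block `r`: `1` for a real eigenvalue, `2` for a
pair of complex ones. -/
def cell (r : Fin p) : ℕ := if F.d r = 0 then 1 else 2

/-- The coordinates, grouped by blocks and cells. -/
abbrev Coord : Type := Σ r : Fin p, Fin (F.n r) × Fin (F.cell r)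

/-- The nilpotent matrix with ones on the first superdiagonal. -/
def shift (n : ℕ) : Matrix (Fin n) (Fin n) ℝ :=
  Matrix.of fun i j => if (i : ℕ) + 1 = (j : ℕ) then 1 else 0

/-- `[c]` for a real eigenvalue, `[[c, -d], [d, c]]` for a complex pair. -/
def D (r : Fin p) : Matrix (Fin (F.cell r)) (Fin (F.cell r)) ℝ :=
  Matrix.of fun i j => if i = j then F.c r else if i < j then -F.d r else F.d r

/-- `[1]` for a real eigenvalue, `[[cos dt, sin dt], [-sin dt, cos dt]]` for a complex pair. -/
def rot (t : ℝ) (r : Fin p) : Matrix (Fin (F.cell r)) (Fin (F.cell r)) ℝ :=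
  Matrix.of fun i j => if i = j then Real.cos (F.d r * t)
    else if i < j then Real.sin (F.d r * t) else -Real.sin (F.d r * t)

/-- The real Jordan form `diag(A_1, …, A_p)`. -/
def Atilde : Matrix F.Coord F.Coord ℝ :=
  Matrix.blockDiagonal' fun r =>
    (1 : Matrix (Fin (F.n r)) (Fin (F.n r)) ℝ) ⊗ₖ F.D r +
      shift (F.n r) ⊗ₖ (1 : Matrix (Fin (F.cell r)) (Fin (F.cell r)) ℝ)

/-- The time-varying transformation `E(t)`. -/
def E (t : ℝ) : Matrix F.Coord F.Coord ℝ :=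
  Matrix.blockDiagonal' fun r =>
    (1 : Matrix (Fin (F.n r)) (Fin (F.n r)) ℝ) ⊗ₖ F.rot t r

/-- `Ā = E A~ E⁻¹ + E' E⁻¹`: every block is the Jordan block of `c r`, tensored with the
identity of the cell. -/
def Abar : Matrix F.Coord F.Coord ℝ :=
  Matrix.blockDiagonal' fun r =>
    (F.c r • (1 : Matrix (Fin (F.n r)) (Fin (F.n r)) ℝ) + shift (F.n r)) ⊗ₖ
      (1 : Matrix (Fin (F.cell r)) (Fin (F.cell r)) ℝ)

end JordanShape

/-! ### The closed loop -/

/-- A matrix is Hurwitz: all its complex eigenvalues have negative real part. -/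
def IsHurwitz {n : ℕ} (M : Matrix (Fin n) (Fin n) ℝ) : Prop :=
  ∀ μ ∈ spectrum ℂ (M.map (algebraMap ℝ ℂ)), μ.re < 0

/-- The Euclidean norm of a real vector. -/
def enorm2 {ι : Type} [Fintype ι] (v : ι → ℝ) : ℝ := ‖WithLp.toLp 2 v‖

variable {nx nu p : ℕ}

/-- `x̄(t) = E(t) S x(t)`. -/
def xbar (F : JordanShape p) (S : Matrix F.Coord (Fin nx) ℝ) (x : ℝ → Fin nx → ℝ) (t : ℝ) :
    F.Coord → ℝ := (F.E t * S) *ᵥ x t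

/-- The control input `u(t) = K S⁻¹ E(t)⁻¹ x̂(t)`. -/
def controlInput (K : Matrix (Fin nu) (Fin nx) ℝ) (F : JordanShape p)
    (Sinv : Matrix (Fin nx) F.Coord ℝ) (xhat : ℝ → F.Coord → ℝ) (t : ℝ) : Fin nu → ℝ :=
  (K * Sinv * (F.E t)⁻¹) *ᵥ xhat t

/-- `(x, x̂, J)` is a trajectory on `[0, ∞[` of the closed loop consisting of the process, the
predictor and the quantization range, where attempt `k` uses `bits r k` bits for every element of
block `r`. `xhatL t` and `JL t` are the left limits `x̂(t⁻)` and `J(t⁻)`, those at `t = 0` being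
the initial conditions. `x` is continuous, `x̂` and `J` are right-continuous and jump only at the
successful transmission instants; the differential equations hold for right
derivatives at every `t ≥ 0`, which includes the starting point of each flow interval. -/
structure IsClosedLoop (A : Matrix (Fin nx) (Fin nx) ℝ) (B : Matrix (Fin nx) (Fin nu) ℝ)
    (K : Matrix (Fin nu) (Fin nx) ℝ) (F : JordanShape p)
    (S : Matrix F.Coord (Fin nx) ℝ) (Sinv : Matrix (Fin nx) F.Coord ℝ)
    (dos : DoS) (Δ : ℝ) (bits : Fin p → ℕ → ℕ)
    (x : ℝ → Fin nx → ℝ) (xhat xhatL J JL : ℝ → F.Coord → ℝ) : Prop where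
  x_cont : ContinuousOn x (Set.Ici 0)
  x_flow : ∀ t : ℝ, 0 ≤ t →
    HasDerivWithinAt x (A *ᵥ x t + B *ᵥ controlInput K F Sinv xhat t) (Set.Ici t) t
  xhat_flow : ∀ t : ℝ, 0 ≤ t →
    HasDerivWithinAt xhat (F.Abar *ᵥ xhat t + (F.E t * S * B) *ᵥ controlInput K F Sinv xhat t)
      (Set.Ici t) t
  J_flow : ∀ t : ℝ, 0 ≤ t → HasDerivWithinAt J (F.Abar *ᵥ J t) (Set.Ici t) t
  xhat_left : ∀ t : ℝ, 0 < t → Tendsto xhat (𝓝[<] t) (𝓝 (xhatL t))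
  J_left : ∀ t : ℝ, 0 < t → Tendsto J (𝓝[<] t) (𝓝 (JL t))
  xhat_init : xhatL 0 = 0
  J_init : ∀ l : F.Coord, |xbar F S x 0 l| < JL 0 l
  no_jump : ∀ t : ℝ, 0 ≤ t → (∀ k : ℕ, dos.Success Δ k → t ≠ (k : ℝ) * Δ) →
    xhat t = xhatL t ∧ J t = JL t
  xhat_jump : ∀ k : ℕ, dos.Success Δ k → ∀ l : F.Coord,
    xhat ((k : ℝ) * Δ) l = xhatL ((k : ℝ) * Δ) l -
      JL ((k : ℝ) * Δ) l * quantizer (bits l.1 k)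
        ((xhatL ((k : ℝ) * Δ) l - xbar F S x ((k : ℝ) * Δ) l) / JL ((k : ℝ) * Δ) l)
  J_jump : ∀ k : ℕ, dos.Success Δ k → ∀ l : F.Coord,
    J ((k : ℝ) * Δ) l = ((2 : ℝ) ^ bits l.1 k)⁻¹ * JL ((k : ℝ) * Δ) l

end QuantizedDoS

end

/-!
A failed attempt is caused either by an attack that starts during the preceding sampling period or
by one that covers this whole period. The frequency and duration bounds therefore leave a fraction
at least `1 - 1/T - Δ/τ_D` of successful attempts, up to an additive constant. Under the bit-rate
condition the synchronization instants of each block then have bounded gaps, and over each gap the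
received bits outweigh the expansion `e^{c_r t}` of the block by a margin uniform in the signal.

In the transformed coordinates `Ā` is real and triangular with nonnegative off-diagonal entries, so
comparison of flows shows that the quantization range `J` dominates the error `x̂ - x̄`
componentwise and is itself dominated by `e^{(c_r + ε) t}` discounted by the received bits. Hence
the range and the error decay exponentially, and the process is the Hurwitz system `A + B K` driven
by an exponentially decaying perturbation.
-/

noncomputable section

namespace QuantizedDoS

/-! ### Counting successful transmissions -/

section Counting

variable (dos : DoS) {Δ : ℝ}

theorem monotone_attemptTime (hΔ : 0 ≤ Δ) : Monotone fun k : ℕ => (k : ℝ) * Δ :=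
  fun _ _ h => by dsimp only; gcongr

theorem Icc_attemptTime_subset (hΔ : 0 ≤ Δ) {a b k : ℕ} (hk : k ∈ Finset.Ioc a b) :
    Set.Icc (((k - 1 : ℕ) : ℝ) * Δ) (k * Δ) ⊆ Set.Icc (a * Δ) (b * Δ) := by
  obtain ⟨hak, hkb⟩ := Finset.mem_Ioc.1 hk
  exact Set.Icc_subset_Icc (monotone_attemptTime hΔ (Nat.le_sub_one_of_lt hak))
    (monotone_attemptTime hΔ hkb)

/-- Some attack starts in the sampling period `]t_{k-1}, t_k]` that ends with attempt `k`
(the period is empty for `k = 0`). -/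
def DoS.HasOnset (Δ : ℝ) (k : ℕ) : Prop :=
  ∃ n : ℕ, (n : ℕ∞) < dos.N ∧ dos.h n ∈ Set.Ioc (((k - 1 : ℕ) : ℝ) * Δ) (k * Δ)

/-- The sampling period `[t_{k-1}, t_k[` preceding attempt `k` is entirely in DoS status. -/
def DoS.IsCovered (Δ : ℝ) (k : ℕ) : Prop :=
  Set.Ico (((k - 1 : ℕ) : ℝ) * Δ) (k * Δ) ⊆ dos.active

theorem DoS.hasOnset_or_isCovered {k : ℕ} (hk : ¬ dos.Success Δ k) :
    dos.HasOnset Δ k ∨ dos.IsCovered Δ k := by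
  obtain ⟨n, hn, hmem⟩ := not_not.1 hk
  have h_le : dos.h n ≤ k * Δ := hmem.elim (fun h => h.ge) fun h => h.1
  rcases lt_or_ge (((k - 1 : ℕ) : ℝ) * Δ) (dos.h n) with hlt | hge
  · exact Or.inl ⟨n, hn, hlt, h_le⟩
  · refine Or.inr fun t ht => ⟨n, hn, Or.inr ⟨hge.trans ht.1, ?_⟩⟩
    rcases hmem with heq | hIco
    · exact absurd (ht.1.trans_lt ht.2) (heq ▸ hge).not_gt
    · exact ht.2.trans hIco.2

open Classical in
theorem DoS.card_hasOnset_le {η τD : ℝ} (hΔ : 0 ≤ Δ) (hf : dos.FrequencyBound η τD) {a b : ℕ}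
    (hab : a ≤ b) :
    (((Finset.Ioc a b).filter (dos.HasOnset Δ)).card : ℝ) ≤ η + (b * Δ - a * Δ) / τD := by
  obtain ⟨hfin, hcard⟩ := hf (a * Δ) (b * Δ) (by positivity) (monotone_attemptTime hΔ hab)
  refine le_trans ?_ hcard
  have honset : ∀ k ∈ (Finset.Ioc a b).filter (dos.HasOnset Δ), dos.HasOnset Δ k :=
    fun k hk => (Finset.mem_filter.1 hk).2
  choose! n hnN hn using honset
  rw [Set.ncard_eq_toFinset_card _ hfin, Nat.cast_le]
  refine Finset.card_le_card_of_injOn n (fun k hk => ?_) fun j hj k hk hjk => ?_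
  · rw [Set.Finite.coe_toFinset]
    exact ⟨hnN k hk, Icc_attemptTime_subset hΔ (Finset.mem_filter.1 hk).1
      (Set.Ioc_subset_Icc_self (hn k hk))⟩
  · by_contra hne
    exact Set.disjoint_left.1 ((monotone_attemptTime hΔ).pairwise_disjoint_on_Ioc_pred hne)
      (hn j hj) (hjk ▸ hn k hk)

theorem volume_biUnion_Ico_attemptTime (hΔ : 0 ≤ Δ) {s : Finset ℕ} (hs : ∀ k ∈ s, 0 < k) :
    volume (⋃ k ∈ s, Set.Ico (((k - 1 : ℕ) : ℝ) * Δ) (k * Δ)) = ENNReal.ofReal (s.card * Δ) := by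
  have hdisjoint : (s : Set ℕ).PairwiseDisjoint
      fun k : ℕ => Set.Ico (((k - 1 : ℕ) : ℝ) * Δ) (k * Δ) :=
    (monotone_attemptTime hΔ).pairwise_disjoint_on_Ico_pred.set_pairwise _
  have hlength : ∀ k ∈ s,
      volume (Set.Ico (((k - 1 : ℕ) : ℝ) * Δ) (k * Δ)) = ENNReal.ofReal Δ := fun k hk => by
    rw [Real.volume_Ico, ← sub_mul, Nat.cast_pred (hs k hk), sub_sub_cancel, one_mul]
  rw [measure_biUnion_finset hdisjoint fun _ _ => measurableSet_Ico,
    Finset.sum_congr rfl hlength, Finset.sum_const, nsmul_eq_mul,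
    ENNReal.ofReal_mul (Nat.cast_nonneg _), ENNReal.ofReal_natCast]

open Classical in
theorem DoS.card_isCovered_le {κ T : ℝ} (hΔ : 0 < Δ) (hκ : 0 ≤ κ) (hT : 0 ≤ T)
    (hd : dos.DurationBound κ T) {a b : ℕ} (hab : a ≤ b) :
    (((Finset.Ioc a b).filter (dos.IsCovered Δ)).card : ℝ) ≤ (κ + (b * Δ - a * Δ) / T) / Δ := by
  set s := (Finset.Ioc a b).filter (dos.IsCovered Δ)
  have hab' : (a : ℝ) * Δ ≤ b * Δ := monotone_attemptTime hΔ.le hab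
  have hsub : ⋃ k ∈ s, Set.Ico (((k - 1 : ℕ) : ℝ) * Δ) (k * Δ) ⊆
      dos.active ∩ Set.Icc (a * Δ) (b * Δ) :=
    Set.iUnion₂_subset fun k hk => Set.subset_inter (Finset.mem_filter.1 hk).2
      (Set.Ico_subset_Icc_self.trans
        (Icc_attemptTime_subset hΔ.le (Finset.mem_filter.1 hk).1))
  have hpos : ∀ k ∈ s, 0 < k := fun k hk =>
    (Nat.zero_le a).trans_lt (Finset.mem_Ioc.1 (Finset.mem_filter.1 hk).1).1
  have hvolume := (measure_mono hsub).trans (hd (a * Δ) (b * Δ) (by positivity) hab')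
  rw [volume_biUnion_Ico_attemptTime hΔ.le hpos, ENNReal.ofReal_le_ofReal_iff
    (add_nonneg hκ (div_nonneg (sub_nonneg.2 hab') hT))] at hvolume
  rwa [le_div_iff₀ hΔ]

open Classical in
/-- The successful attempts with index in `]a, b]`. -/
def DoS.successes (Δ : ℝ) (a b : ℕ) : Finset ℕ :=
  (Finset.Ioc a b).filter (dos.Success Δ)

variable {dos} in
theorem DoS.mem_successes {a b k : ℕ} :
    k ∈ dos.successes Δ a b ↔ a < k ∧ k ≤ b ∧ dos.Success Δ k := by
  simp [DoS.successes, and_assoc]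

theorem DoS.card_successes_le (Δ : ℝ) (a b : ℕ) : (dos.successes Δ a b).card ≤ b - a := by
  classical
  exact (Finset.card_filter_le _ _).trans_eq (Nat.card_Ioc a b)

theorem DoS.ncard_success_eq (a b : ℕ) :
    {j | a < j ∧ j ≤ b ∧ dos.Success Δ j}.ncard = (dos.successes Δ a b).card := by
  rw [← Set.ncard_coe_finset]
  congr 1
  ext k
  simp [DoS.mem_successes]

theorem DoS.card_successes_ge {η τD κ T : ℝ} (hΔ : 0 < Δ) (hκ : 0 ≤ κ) (hT : 0 ≤ T)
    (hf : dos.FrequencyBound η τD) (hd : dos.DurationBound κ T) {a b : ℕ} (hab : a ≤ b) :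
    (1 - 1 / T - Δ / τD) * (b - a) - (κ / Δ + η) ≤ ((dos.successes Δ a b).card : ℝ) := by
  classical
  have hsub : Finset.Ioc a b ⊆ dos.successes Δ a b ∪
      ((Finset.Ioc a b).filter (dos.HasOnset Δ) ∪ (Finset.Ioc a b).filter (dos.IsCovered Δ)) := by
    intro k hk
    have hcases := or_iff_not_imp_left.2 (dos.hasOnset_or_isCovered (Δ := Δ) (k := k))
    simpa only [DoS.successes, Finset.mem_union, Finset.mem_filter, hk, true_and] using hcases
  have hcard := (Finset.card_le_card hsub).trans ((Finset.card_union_le _ _).trans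
    (add_le_add_right (Finset.card_union_le _ _) _))
  rw [Nat.card_Ioc, ← Nat.cast_le (α := ℝ)] at hcard
  push_cast [hab] at hcard
  have honset := dos.card_hasOnset_le hΔ.le hf hab
  have hcovered := dos.card_isCovered_le hΔ hκ hT hd hab
  have hduration : (κ + (b * Δ - a * Δ) / T) / Δ = κ / Δ + 1 / T * (b - a) := by
    field_simp
  have hfrequency : (b * Δ - a * Δ) / τD = Δ / τD * (b - a) := by ring
  linarith

end Counting

/-! ### The received bits outweigh the expansion of a block -/

section Bits

variable {dos : DoS} {Δ c w : ℝ} {R L : ℕ} {bits : ℕ → ℕ}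

theorem decayRatio_lt_one_iff {a k m : ℕ} :
    decayRatio Δ c R a k m < 1 ↔ c * Δ * (k - a) < R * Real.log 2 * m := by
  rw [decayRatio, div_lt_one (by positivity), ← Real.lt_log_iff_exp_lt (by positivity),
    Real.log_pow, Real.log_pow]
  ring_nf

theorem rate_lt_of_bits_lt {ρ : ℝ} (hρ : 0 < ρ)
    (hR : 1 / ρ * c * Δ * Real.logb 2 (Real.exp 1) < R) :
    c * Δ < ρ * (R * Real.log 2) := by
  have hlog : 0 < Real.log 2 := Real.log_pos one_lt_two
  rw [Real.logb, Real.log_exp] at hR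
  calc c * Δ = ρ * Real.log 2 * (1 / ρ * c * Δ * (1 / Real.log 2)) := by field_simp
    _ < ρ * Real.log 2 * R := by gcongr
    _ = ρ * (R * Real.log 2) := by ring

/-- After a synchronization at attempt `a`, the successful attempt `k` is a candidate for the next
one: `e^{c (t_k - t_a)} / (2^R)^{T_S(t_a, t_k)} < 1`. -/
def DoS.IsSyncCandidate (dos : DoS) (Δ c : ℝ) (R a k : ℕ) : Prop :=
  a < k ∧ dos.Success Δ k ∧ decayRatio Δ c R a k (dos.successes Δ a k).card < 1

/-- From every attempt, a synchronization candidate is reached within `L` attempts. -/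
def DoS.ReachesSyncWithin (dos : DoS) (Δ c : ℝ) (R L : ℕ) : Prop :=
  ∀ a, ∃ k ≤ a + L, dos.IsSyncCandidate Δ c R a k

theorem DoS.exists_last_success {a b : ℕ} (hne : (dos.successes Δ a b).Nonempty) :
    ∃ k, a < k ∧ k ≤ b ∧ dos.Success Δ k ∧
      (dos.successes Δ a b).card ≤ (dos.successes Δ a k).card := by
  obtain ⟨hak, hkb, hk⟩ := DoS.mem_successes.1 (Finset.max'_mem _ hne)
  refine ⟨_, hak, hkb, hk, Finset.card_le_card fun j hj => ?_⟩
  obtain ⟨haj, -, hj'⟩ := DoS.mem_successes.1 hj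
  exact DoS.mem_successes.2 ⟨haj, Finset.le_max' _ _ hj, hj'⟩

theorem exists_reachesSyncWithin {η τD κ T : ℝ} (hΔ : 0 < Δ) (hκ : 0 ≤ κ) (hT : 0 ≤ T)
    (hc : 0 ≤ c) (hR : c * Δ < (1 - 1 / T - Δ / τD) * (R * Real.log 2)) :
    ∃ L : ℕ, ∀ dos : DoS, dos.FrequencyBound η τD → dos.DurationBound κ T →
      dos.ReachesSyncWithin Δ c R L := by
  set ρ := 1 - 1 / T - Δ / τD
  set β := κ / Δ + η
  have hγ : 0 ≤ R * Real.log 2 := by positivity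
  obtain ⟨L, hL⟩ := exists_nat_gt (R * Real.log 2 * β / (ρ * (R * Real.log 2) - c * Δ))
  rw [div_lt_iff₀ (sub_pos.2 hR)] at hL
  refine ⟨L, fun dos hf hd a => ?_⟩
  have hcount : ρ * L - β ≤ ((dos.successes Δ a (a + L)).card : ℝ) := by
    have hge := dos.card_successes_ge hΔ hκ hT hf hd (Nat.le_add_right a L)
    rwa [Nat.cast_add, add_sub_cancel_left] at hge
  have hbeat : c * Δ * L < R * Real.log 2 * (dos.successes Δ a (a + L)).card := by
    nlinarith [mul_le_mul_of_nonneg_left hcount hγ]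
  have hpos : (0 : ℝ) < (dos.successes Δ a (a + L)).card :=
    pos_of_mul_pos_right ((by positivity : 0 ≤ c * Δ * L).trans_lt hbeat) hγ
  obtain ⟨k, hak, hkL, hk, hcard⟩ :=
    dos.exists_last_success (Finset.card_pos.1 (Nat.cast_pos.1 hpos))
  refine ⟨k, hkL, hak, hk, decayRatio_lt_one_iff.2 ?_⟩
  have hkL' : (k : ℝ) - a ≤ L := sub_le_iff_le_add'.2 (by exact_mod_cast hkL)
  calc c * Δ * (k - a) ≤ c * Δ * L := by gcongr
    _ < R * Real.log 2 * (dos.successes Δ a (a + L)).card := hbeat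
    _ ≤ R * Real.log 2 * (dos.successes Δ a k).card := by gcongr

open Classical in
/-- The number of bits (per element of the block) received at attempt `k`. -/
def receivedBits (dos : DoS) (Δ : ℝ) (bits : ℕ → ℕ) (k : ℕ) : ℕ :=
  if dos.Success Δ k then bits k else 0

/-- The number of bits (per element of the block) received up to and including attempt `k`. -/
def totalBits (dos : DoS) (Δ : ℝ) (bits : ℕ → ℕ) (k : ℕ) : ℕ :=
  ∑ j ∈ Finset.range (k + 1), receivedBits dos Δ bits j

theorem totalBits_add_sum {a b : ℕ} (hab : a ≤ b) :
    totalBits dos Δ bits a + ∑ j ∈ dos.successes Δ a b, bits j = totalBits dos Δ bits b := by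
  classical
  rw [totalBits, totalBits, DoS.successes, Finset.sum_filter,
    ← Finset.sum_range_add_sum_Ico _ (Nat.succ_le_succ hab),
    Nat.succ_eq_add_one, Nat.succ_eq_add_one, Finset.Ico_add_one_add_one_eq_Ioc]
  rfl

theorem totalBits_mono : Monotone (totalBits dos Δ bits) := fun _ _ hab =>
  (Nat.le_add_right _ _).trans_eq (totalBits_add_sum hab)

local notation "σ" => syncAttempt dos Δ c R

theorem syncAttempt_succ (g : ℕ) :
    σ (g + 1) = sInf {k | dos.IsSyncCandidate Δ c R (σ g) k} := by
  simp only [syncAttempt, DoS.ncard_success_eq, DoS.IsSyncCandidate]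

theorem syncAttempt_zero_le (hsync : dos.ReachesSyncWithin Δ c R L) : σ 0 ≤ L := by
  obtain ⟨k, hkL, hk⟩ := hsync 0
  exact (Nat.sInf_le hk.2.1).trans (hkL.trans_eq (zero_add L))

theorem isSyncCandidate_syncAttempt (hsync : dos.ReachesSyncWithin Δ c R L) (g : ℕ) :
    dos.IsSyncCandidate Δ c R (σ g) (σ (g + 1)) := by
  have hne : {k | dos.IsSyncCandidate Δ c R (σ g) k}.Nonempty :=
    (hsync (σ g)).imp fun _ hk => hk.2
  rw [syncAttempt_succ]
  exact Nat.sInf_mem hne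

theorem syncAttempt_succ_le (hsync : dos.ReachesSyncWithin Δ c R L) (g : ℕ) :
    σ (g + 1) ≤ σ g + L := by
  obtain ⟨k, hkL, hk⟩ := hsync (σ g)
  rw [syncAttempt_succ]
  exact (Nat.sInf_le hk).trans hkL

theorem strictMono_syncAttempt (hsync : dos.ReachesSyncWithin Δ c R L) : StrictMono σ :=
  strictMono_nat_of_lt_succ fun g => (isSyncCandidate_syncAttempt hsync g).1

open Classical in
theorem bitRule_of_success {a k : ℕ} (hak : a < k) (hk : dos.Success Δ k) :
    bitRule dos Δ c w R a k =
      if dos.IsSyncCandidate Δ c R a k then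
        min ⌈w * ((k : ℝ) * Δ - (a : ℝ) * Δ) * Real.logb 2 (Real.exp 1)⌉₊ R
      else R := by
  have hinsert : {j | a < j ∧ j ≤ k ∧ dos.Success Δ j} =
      insert k {j | a < j ∧ j < k ∧ dos.Success Δ j} := by
    ext j
    simp only [Set.mem_insert_iff, Set.mem_ofPred_eq]
    grind
  have hcount : {j | a < j ∧ j < k ∧ dos.Success Δ j}.ncard + 1 =
      (dos.successes Δ a k).card := by
    rw [← DoS.ncard_success_eq, hinsert, Set.ncard_insert_of_notMem (fun h => lt_irrefl _ h.2.1)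
      ((Set.finite_Iio k).subset fun j hj => hj.2.1)]
  simp only [bitRule, hcount, DoS.IsSyncCandidate, hak, hk, true_and]

/-- The bit protocol of a single block with expansion rate `c`. -/
def FollowsBlockProtocol (dos : DoS) (Δ c w : ℝ) (R : ℕ) (bits : ℕ → ℕ) : Prop :=
  ∀ g k, syncAttempt dos Δ c R g < k → k ≤ syncAttempt dos Δ c R (g + 1) →
    bits k = bitRule dos Δ c w R (syncAttempt dos Δ c R g) k

theorem bits_eq_of_lt_syncAttempt (hbits : FollowsBlockProtocol dos Δ c w R bits) {g k : ℕ}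
    (hk : dos.Success Δ k) (hlt : σ g < k) (hlt' : k < σ (g + 1)) : bits k = R := by
  rw [hbits g k hlt hlt'.le, bitRule_of_success hlt hk, if_neg]
  rw [syncAttempt_succ] at hlt'
  exact Nat.notMem_of_lt_sInf hlt'

theorem bits_syncAttempt (hsync : dos.ReachesSyncWithin Δ c R L)
    (hbits : FollowsBlockProtocol dos Δ c w R bits) (g : ℕ) :
    bits (σ (g + 1)) =
      min ⌈w * ((σ (g + 1) : ℝ) * Δ - (σ g : ℝ) * Δ) * Real.logb 2 (Real.exp 1)⌉₊ R := by
  have hcandidate := isSyncCandidate_syncAttempt hsync g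
  rw [hbits g _ hcandidate.1 le_rfl, bitRule_of_success hcandidate.1 hcandidate.2.1,
    if_pos hcandidate]

theorem sum_bits_eq_or_le (hsync : dos.ReachesSyncWithin Δ c R L)
    (hbits : FollowsBlockProtocol dos Δ c w R bits) (g : ℕ) :
    ∑ j ∈ dos.successes Δ (σ g) (σ (g + 1)), bits j =
        (dos.successes Δ (σ g) (σ (g + 1))).card * R ∨
      w * Δ * (σ (g + 1) - σ g) ≤
        Real.log 2 * ∑ j ∈ dos.successes Δ (σ g) (σ (g + 1)), (bits j : ℝ) := by
  obtain ⟨hlt, hsucc, -⟩ := isSyncCandidate_syncAttempt hsync g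
  have hlast := bits_syncAttempt hsync hbits g
  rcases le_total R ⌈w * ((σ (g + 1) : ℝ) * Δ - (σ g : ℝ) * Δ) * Real.logb 2 (Real.exp 1)⌉₊
    with hle | hle
  · left
    refine Finset.sum_const_nat fun j hj => ?_
    obtain ⟨hgj, hjg, hj'⟩ := DoS.mem_successes.1 hj
    rcases hjg.eq_or_lt with rfl | hlt
    · rw [hlast, min_eq_right hle]
    · exact bits_eq_of_lt_syncAttempt hbits hj' hgj hlt
  · right
    rw [min_eq_left hle] at hlast
    have hlog : 0 < Real.log 2 := Real.log_pos one_lt_two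
    calc w * Δ * (σ (g + 1) - σ g)
        = Real.log 2 *
            (w * ((σ (g + 1) : ℝ) * Δ - (σ g : ℝ) * Δ) * Real.logb 2 (Real.exp 1)) := by
          rw [Real.logb, Real.log_exp]
          field_simp [hlog.ne']
      _ ≤ Real.log 2 * bits (σ (g + 1)) := by
          rw [hlast]
          gcongr
          exact Nat.le_ceil _
      _ ≤ Real.log 2 * ∑ j ∈ dos.successes Δ (σ g) (σ (g + 1)), (bits j : ℝ) := by
          gcongr
          exact Finset.single_le_sum (f := fun j => (bits j : ℝ)) (fun _ _ => Nat.cast_nonneg _)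
            (DoS.mem_successes.2 ⟨hlt, le_rfl, hsucc⟩)

/-- Whenever `m` messages strictly outweigh an expansion over `l` periods, they do so with
margin `θ` per period, as long as `l, m ≤ L`. -/
def IsRateMargin (α γ : ℝ) (L : ℕ) (θ : ℝ) : Prop :=
  ∀ l ≤ L, ∀ m ≤ L, α * l < γ * m → (α + θ) * l ≤ γ * m

theorem eventually_isRateMargin (α γ : ℝ) (L : ℕ) : ∀ᶠ θ in 𝓝[>] 0, IsRateMargin α γ L θ := by
  refine ((Set.finite_Iic L).eventually_all).2 fun l _ =>
    ((Set.finite_Iic L).eventually_all).2 fun m _ => ?_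
  rw [Filter.eventually_imp_distrib_left]
  intro hlm
  have hcont : Continuous fun θ : ℝ => (α + θ) * l := by fun_prop
  have htendsto : Tendsto (fun θ : ℝ => (α + θ) * l) (𝓝[>] 0) (𝓝 (α * l)) := by
    simpa using (hcont.tendsto 0).mono_left nhdsWithin_le_nhds
  exact htendsto.eventually_le_const hlm

theorem margin_le_sum_bits {θ : ℝ} (hsync : dos.ReachesSyncWithin Δ c R L)
    (hθ : IsRateMargin (c * Δ) (R * Real.log 2) L θ) (hθw : c * Δ + θ ≤ w * Δ)
    (hbits : FollowsBlockProtocol dos Δ c w R bits) (g : ℕ) :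
    (c * Δ + θ) * (σ (g + 1) - σ g) ≤
      Real.log 2 * ∑ j ∈ dos.successes Δ (σ g) (σ (g + 1)), (bits j : ℝ) := by
  obtain ⟨hlt, -, hratio⟩ := isSyncCandidate_syncAttempt hsync g
  rcases sum_bits_eq_or_le hsync hbits g with hfull | hceil
  · have hgap : σ (g + 1) - σ g ≤ L := Nat.sub_le_iff_le_add'.2 (syncAttempt_succ_le hsync g)
    have hmargin := hθ _ hgap _ ((dos.card_successes_le Δ _ _).trans hgap)
    rw [Nat.cast_sub hlt.le] at hmargin
    rw [← Nat.cast_sum, hfull, Nat.cast_mul]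
    linarith [hmargin (decayRatio_lt_one_iff.1 hratio)]
  · have hle : (σ g : ℝ) ≤ σ (g + 1) := Nat.cast_le.2 hlt.le
    exact (mul_le_mul_of_nonneg_right hθw (sub_nonneg.2 hle)).trans hceil

theorem margin_le_totalBits_syncAttempt {θ : ℝ} (hsync : dos.ReachesSyncWithin Δ c R L)
    (hθ : IsRateMargin (c * Δ) (R * Real.log 2) L θ) (hθw : c * Δ + θ ≤ w * Δ)
    (hbits : FollowsBlockProtocol dos Δ c w R bits) (g : ℕ) :
    (c * Δ + θ) * (σ g - σ 0) ≤ Real.log 2 * totalBits dos Δ bits (σ g) := by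
  induction g with
  | zero =>
    rw [sub_self, mul_zero]
    positivity
  | succ g ih =>
    have hperiod := margin_le_sum_bits hsync hθ hθw hbits g
    rw [← totalBits_add_sum (strictMono_syncAttempt hsync g.lt_succ_self).le]
    push_cast
    linarith

theorem margin_le_totalBits {θ : ℝ} (hα : 0 ≤ c * Δ + θ) (hsync : dos.ReachesSyncWithin Δ c R L)
    (hθ : IsRateMargin (c * Δ) (R * Real.log 2) L θ) (hθw : c * Δ + θ ≤ w * Δ)
    (hbits : FollowsBlockProtocol dos Δ c w R bits) (k : ℕ) :
    (c * Δ + θ) * (k - 2 * L) ≤ Real.log 2 * totalBits dos Δ bits k := by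
  have hzero := syncAttempt_zero_le hsync
  rcases le_or_gt k (σ 0) with hk | hk
  · have hkL : (k : ℝ) ≤ 2 * L := by exact_mod_cast (by lia : k ≤ 2 * L)
    calc (c * Δ + θ) * (k - 2 * L) ≤ 0 := mul_nonpos_of_nonneg_of_nonpos hα (by linarith)
      _ ≤ Real.log 2 * totalBits dos Δ bits k := by positivity
  · have hstrict := strictMono_syncAttempt hsync
    obtain ⟨g, hgk, hkg⟩ := hstrict.exists_between_of_tendsto_atTop hstrict.tendsto_atTop hk
    have hkL : (k : ℝ) - 2 * L ≤ σ g - σ 0 := by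
      have : (k : ℝ) + σ 0 ≤ σ g + 2 * L := by
        exact_mod_cast (by linarith [syncAttempt_succ_le hsync g])
      linarith
    calc (c * Δ + θ) * (k - 2 * L)
        ≤ (c * Δ + θ) * (σ g - σ 0) := by gcongr
      _ ≤ Real.log 2 * totalBits dos Δ bits (σ g) :=
          margin_le_totalBits_syncAttempt hsync hθ hθw hbits g
      _ ≤ Real.log 2 * totalBits dos Δ bits k := by
          gcongr
          exact totalBits_mono hgk.le

theorem exp_mul_inv_pow_totalBits_le {θ : ℝ} (hΔ : 0 < Δ) (hα : 0 ≤ c * Δ + θ)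
    (hsync : dos.ReachesSyncWithin Δ c R L) (hθ : IsRateMargin (c * Δ) (R * Real.log 2) L θ)
    (hθw : c * Δ + θ ≤ w * Δ) (hbits : FollowsBlockProtocol dos Δ c w R bits) {k : ℕ} {t : ℝ}
    (ht : t ≤ (k + 1) * Δ) :
    Real.exp (c * t) * ((2 : ℝ) ^ totalBits dos Δ bits k)⁻¹ ≤
      Real.exp ((c * Δ + θ) * (2 * L + 1)) * Real.exp (-(θ / Δ) * t) := by
  have hpow : ((2 : ℝ) ^ totalBits dos Δ bits k)⁻¹ =
      Real.exp (-(Real.log 2 * totalBits dos Δ bits k)) := by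
    rw [Real.exp_neg, mul_comm, Real.exp_nat_mul, Real.exp_log two_pos]
  rw [hpow, ← Real.exp_add, ← Real.exp_add, Real.exp_le_exp]
  have hmargin := margin_le_totalBits hα hsync hθ hθw hbits k
  have hrate : (c + θ / Δ) * t ≤ (c * Δ + θ) * (k + 1) := by
    calc (c + θ / Δ) * t = (c * Δ + θ) * (t / Δ) := by field_simp
      _ ≤ (c * Δ + θ) * (k + 1) := by gcongr; rwa [div_le_iff₀ hΔ]
  linarith

theorem exists_exp_mul_inv_pow_totalBits_le {η τD κ T : ℝ} (hΔ : 0 < Δ) (hκ : 0 ≤ κ)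
    (hT : 0 ≤ T) (hρ : 0 < 1 - 1 / T - Δ / τD)
    (hR : 0 ≤ c → 1 / (1 - 1 / T - Δ / τD) * c * Δ * Real.logb 2 (Real.exp 1) < R)
    (hw : c < w) :
    ∃ C μ : ℝ, 0 < C ∧ 0 < μ ∧ ∀ dos : DoS, dos.FrequencyBound η τD → dos.DurationBound κ T →
      ∀ bits : ℕ → ℕ, FollowsBlockProtocol dos Δ c w R bits →
      ∀ (k : ℕ) (t : ℝ), t ≤ (k + 1) * Δ →
        Real.exp (c * t) * ((2 : ℝ) ^ totalBits dos Δ bits k)⁻¹ ≤ C * Real.exp (-μ * t) := by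
  rcases lt_or_ge c 0 with hc | hc
  · refine ⟨1, -c, one_pos, neg_pos.2 hc, fun dos _ _ bits _ k t _ => ?_⟩
    rw [neg_neg, one_mul]
    exact mul_le_of_le_one_right (Real.exp_pos _).le
      (inv_le_one_of_one_le₀ (one_le_pow₀ one_le_two))
  · obtain ⟨L, hL⟩ := exists_reachesSyncWithin (η := η) hΔ hκ hT hc (rate_lt_of_bits_lt hρ (hR hc))
    have hgap : 0 < (w - c) * Δ := mul_pos (sub_pos.2 hw) hΔ
    obtain ⟨θ, hθ, hθw, hθ0⟩ := ((eventually_isRateMargin (c * Δ) (R * Real.log 2) L).and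
      ((eventually_nhdsWithin_of_eventually_nhds (eventually_le_nhds hgap)).and
        self_mem_nhdsWithin)).exists
    exact ⟨_, θ / Δ, Real.exp_pos _, div_pos hθ0 hΔ, fun dos hf hd bits hbits k t ht =>
      exp_mul_inv_pow_totalBits_le hΔ (by positivity) (hL dos hf hd) hθ (by linarith) hbits ht⟩

end Bits

/-! ### The quantizer -/

theorem abs_sub_quantizer_le (R : ℕ) {χ : ℝ} (hχ : |χ| ≤ 1) :
    |χ - quantizer R χ| ≤ ((2 : ℝ) ^ R)⁻¹ := by
  rcases R with _ | m
  · simpa [quantizer] using hχ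
  · have hstep : ((2 : ℝ) ^ (m + 1))⁻¹ = (1 / 2) / 2 ^ m := by
      rw [pow_succ]
      field_simp
    rw [quantizer, if_neg m.succ_ne_zero, Nat.add_sub_cancel, hstep]
    split_ifs with h
    · have hfract : χ - ((⌊(2 : ℝ) ^ m * χ⌋ : ℝ) + 0.5) / 2 ^ m =
          (Int.fract ((2 : ℝ) ^ m * χ) - 1 / 2) / 2 ^ m := by
        rw [Int.fract]
        field_simp
        ring
      rw [hfract, abs_div, abs_of_pos (by positivity : (0 : ℝ) < 2 ^ m)]
      gcongr
      rw [abs_le]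
      constructor <;> linarith [Int.fract_nonneg ((2 : ℝ) ^ m * χ),
        Int.fract_lt_one ((2 : ℝ) ^ m * χ)]
    · have hχ1 : χ = 1 := le_antisymm (abs_le.1 hχ).2 (not_lt.1 h)
      rw [hχ1, sub_sub_cancel, abs_of_nonneg (by positivity)]
      norm_num

theorem abs_sub_mul_quantizer_le (R : ℕ) {e j : ℝ} (he : |e| ≤ j) :
    |e - j * quantizer R (e / j)| ≤ ((2 : ℝ) ^ R)⁻¹ * j := by
  rcases ((abs_nonneg e).trans he).eq_or_lt with rfl | hj
  · simpa using he
  · have hratio : |e / j| ≤ 1 := by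
      rw [abs_div, abs_of_pos hj]
      exact div_le_one_of_le₀ he hj.le
    have hscale : e - j * quantizer R (e / j) = (e / j - quantizer R (e / j)) * j := by
      field_simp
    rw [hscale, abs_mul, abs_of_pos hj]
    gcongr
    exact abs_sub_quantizer_le R hratio

/-! ### Flows between two instants -/

section Flow

variable {V : Type*} [NormedAddCommGroup V] [NormedSpace ℝ V] {a b : ℝ}

/-- `z` has right derivative `z'` on `[a, b[`, left limits `zL` on `]a, b]`, and no jump inside
`]a, b[`. Its value at `b`, where the next jump may take place, is left unspecified. -/
structure HasFlowOn (z z' zL : ℝ → V) (a b : ℝ) : Prop where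
  hasDerivWithinAt : ∀ t ∈ Set.Ico a b, HasDerivWithinAt z (z' t) (Set.Ici t) t
  tendsto_left : ∀ t ∈ Set.Ioc a b, Tendsto z (𝓝[<] t) (𝓝 (zL t))
  eq_left : ∀ t ∈ Set.Ioo a b, z t = zL t

namespace HasFlowOn

variable {z z' zL y y' yL : ℝ → V}

theorem of_hasDerivWithinAt (hz : ∀ t ∈ Set.Ico a b, HasDerivWithinAt z (z' t) (Set.Ici t) t)
    (hcont : ContinuousOn z (Set.Ioc a b)) : HasFlowOn z z' z a b where
  hasDerivWithinAt := hz
  tendsto_left t ht := (hcont t ht).mono_left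
    (nhdsWithin_le_of_mem (Filter.mem_of_superset (Ioo_mem_nhdsLT ht.1)
      fun _ hs => ⟨hs.1, hs.2.le.trans ht.2⟩))
  eq_left _ _ := rfl

theorem continuousOn (hz : HasFlowOn z z' zL a b) : ContinuousOn z (Set.Ico a b) := by
  intro t ht
  have hright := (hz.hasDerivWithinAt t ht).continuousWithinAt
  rcases ht.1.eq_or_lt with rfl | hat
  · exact hright.mono Set.Ico_subset_Ici_self
  · have hleft : ContinuousWithinAt z (Set.Iio t) t := by
      rw [ContinuousWithinAt, hz.eq_left t ⟨hat, ht.2⟩]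
      exact hz.tendsto_left t ⟨hat, ht.2.le⟩
    exact (continuousAt_iff_continuous_left'_right'.2
      ⟨hleft, hright.mono Set.Ioi_subset_Ici_self⟩).continuousWithinAt

theorem neg (hz : HasFlowOn z z' zL a b) : HasFlowOn (-z) (-z') (-zL) a b where
  hasDerivWithinAt t ht := (hz.hasDerivWithinAt t ht).neg
  tendsto_left t ht := (hz.tendsto_left t ht).neg
  eq_left t ht := congrArg Neg.neg (hz.eq_left t ht)

theorem sub (hz : HasFlowOn z z' zL a b) (hy : HasFlowOn y y' yL a b) :
    HasFlowOn (z - y) (z' - y') (zL - yL) a b where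
  hasDerivWithinAt t ht := (hz.hasDerivWithinAt t ht).sub (hy.hasDerivWithinAt t ht)
  tendsto_left t ht := (hz.tendsto_left t ht).sub (hy.tendsto_left t ht)
  eq_left t ht := congrArg₂ (· - ·) (hz.eq_left t ht) (hy.eq_left t ht)

end HasFlowOn

theorem nonneg_of_mul_le_deriv_right {f f' : ℝ → ℝ} {c : ℝ} (hf : ContinuousOn f (Set.Icc a b))
    (hf' : ∀ t ∈ Set.Ico a b, HasDerivWithinAt f (f' t) (Set.Ici t) t)
    (hge : ∀ t ∈ Set.Ico a b, c * f t ≤ f' t) (h0 : 0 ≤ f a) :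
    ∀ t ∈ Set.Icc a b, 0 ≤ f t := by
  have hexp : ∀ t, HasDerivAt (fun t => Real.exp (-c * t)) (Real.exp (-c * t) * -c) t := fun t => by
    simpa using ((hasDerivAt_id t).const_mul (-c)).exp
  have hderiv_nonneg : ∀ t ∈ Set.Ico a b,
      0 ≤ Real.exp (-c * t) * -c * f t + Real.exp (-c * t) * f' t := fun t ht => by
    have := mul_nonneg (Real.exp_pos (-c * t)).le (sub_nonneg.2 (hge t ht))
    linarith
  have hmono := image_le_of_deriv_right_le_deriv_boundary (f := fun _ => (0 : ℝ))
    (f' := fun _ => 0) (a := a) (b := b) continuousOn_const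
    (fun t _ => hasDerivWithinAt_const _ _ _) (B := fun t => Real.exp (-c * t) * f t)
    (B' := fun t => Real.exp (-c * t) * -c * f t + Real.exp (-c * t) * f' t)
    (mul_nonneg (Real.exp_pos _).le h0) ((Continuous.continuousOn (by fun_prop)).mul hf)
    (fun t ht => (hexp t).hasDerivWithinAt.mul (hf' t ht)) hderiv_nonneg
  exact fun t ht => (mul_nonneg_iff_of_pos_left (Real.exp_pos _)).1 (hmono ht)

end Flow

/-! ### Comparison for the transformed dynamics -/

namespace JordanShape

section Comparison

variable {p : ℕ} (F : JordanShape p) {a b : ℝ}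

theorem sum_shift_mul {n : ℕ} (i : Fin n) (v : Fin n → ℝ) :
    ∑ j, shift n i j * v j = if h : (i : ℕ) + 1 < n then v ⟨i + 1, h⟩ else 0 := by
  split_ifs with h
  · rw [Fintype.sum_eq_single ⟨i + 1, h⟩ fun j hj => ?_]
    · simp [shift]
    · have hne : (i : ℕ) + 1 ≠ j := fun heq => hj (Fin.ext heq.symm)
      simp [shift, hne]
  · refine Finset.sum_eq_zero fun j _ => ?_
    have hne : (i : ℕ) + 1 ≠ j := fun heq => h (heq ▸ j.2)
    simp [shift, hne]

theorem Abar_mulVec_apply (v : F.Coord → ℝ) (r : Fin p) (i : Fin (F.n r))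
    (s : Fin (F.cell r)) :
    (F.Abar *ᵥ v) ⟨r, i, s⟩ = F.c r * v ⟨r, i, s⟩ +
      if h : (i : ℕ) + 1 < F.n r then v ⟨r, ⟨i + 1, h⟩, s⟩ else 0 := by
  rw [Matrix.mulVec, dotProduct, Fintype.sum_sigma, Fintype.sum_eq_single r]
  · rw [← sum_shift_mul i fun j => v ⟨r, j, s⟩]
    simp only [Abar, Matrix.blockDiagonal'_apply_eq, Matrix.kronecker_apply, Fintype.sum_prod_type,
      Matrix.one_apply, mul_ite, mul_one, mul_zero, ite_mul, zero_mul, Finset.sum_ite_eq,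
      Finset.mem_univ, if_true, Matrix.add_apply, Matrix.smul_apply, smul_eq_mul, add_mul,
      Finset.sum_add_distrib]
  · intro r' hr'
    refine Finset.sum_eq_zero fun q _ => ?_
    rw [Abar, Matrix.blockDiagonal'_apply_ne _ _ _ (Ne.symm hr'), zero_mul]

/- Within a block, coordinate `i` is driven only by coordinate `i + 1`, so nonnegativity propagates
upwards from the last cell. -/
theorem nonneg_of_Abar_mulVec_le_deriv {z z' : ℝ → F.Coord → ℝ}
    (hz : ContinuousOn z (Set.Icc a b))
    (hz' : ∀ t ∈ Set.Ico a b, HasDerivWithinAt z (z' t) (Set.Ici t) t)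
    (hge : ∀ t ∈ Set.Ico a b, F.Abar *ᵥ z t ≤ z' t) (h0 : 0 ≤ z a) :
    ∀ t ∈ Set.Icc a b, 0 ≤ z t := by
  have hcell : ∀ (m : ℕ) (r : Fin p) (i : Fin (F.n r)) (s : Fin (F.cell r)), F.n r ≤ i + m →
      ∀ t ∈ Set.Icc a b, 0 ≤ z t ⟨r, i, s⟩ := by
    intro m
    induction m with
    | zero => exact fun r i s h => absurd i.2 h.not_gt
    | succ m ih =>
      intro r i s h
      refine nonneg_of_mul_le_deriv_right (c := F.c r) (continuousOn_pi.1 hz ⟨r, i, s⟩)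
        (fun t ht => hasDerivWithinAt_pi.1 (hz' t ht) _) (fun t ht => ?_) (h0 _)
      refine le_trans ?_ (hge t ht ⟨r, i, s⟩)
      rw [Abar_mulVec_apply, le_add_iff_nonneg_right]
      split_ifs with hi
      · exact ih r ⟨i + 1, hi⟩ s (by dsimp only; lia) t ⟨ht.1, ht.2.le⟩
      · exact le_rfl
  rintro t ht ⟨r, i, s⟩
  exact hcell (F.n r) r i s (Nat.le_add_left _ _) t ht

theorem le_of_hasFlowOn {u u' uL v v' vL : ℝ → F.Coord → ℝ} (hab : a < b)
    (hu : HasFlowOn u u' uL a b) (hv : HasFlowOn v v' vL a b)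
    (hu' : ∀ t ∈ Set.Ico a b, u' t ≤ F.Abar *ᵥ u t)
    (hv' : ∀ t ∈ Set.Ico a b, F.Abar *ᵥ v t ≤ v' t) (h0 : u a ≤ v a) :
    (∀ t ∈ Set.Ico a b, u t ≤ v t) ∧ uL b ≤ vL b := by
  have hz := hv.sub hu
  have hle : ∀ t ∈ Set.Ico a b, u t ≤ v t := fun t ht => by
    have hsub : Set.Ico a t ⊆ Set.Ico a b := Set.Ico_subset_Ico_right ht.2.le
    refine sub_nonneg.1 (F.nonneg_of_Abar_mulVec_le_deriv
      (hz.continuousOn.mono (Set.Icc_subset_Ico_right ht.2))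
      (fun s hs => hz.hasDerivWithinAt s (hsub hs)) (fun s hs => ?_) (sub_nonneg.2 h0)
      t ⟨ht.1, le_rfl⟩)
    rw [Pi.sub_apply, Pi.sub_apply, Matrix.mulVec_sub]
    exact sub_le_sub (hv' s (hsub hs)) (hu' s (hsub hs))
  refine ⟨hle, le_of_tendsto_of_tendsto (hu.tendsto_left b ⟨hab, le_rfl⟩)
    (hv.tendsto_left b ⟨hab, le_rfl⟩) ?_⟩
  filter_upwards [Ioo_mem_nhdsLT hab] with t ht using hle t ⟨ht.1.le, ht.2⟩

theorem abs_le_of_hasFlowOn {e eL J JL : ℝ → F.Coord → ℝ} (hab : a < b)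
    (he : HasFlowOn e (fun t => F.Abar *ᵥ e t) eL a b)
    (hJ : HasFlowOn J (fun t => F.Abar *ᵥ J t) JL a b) (h0 : |e a| ≤ J a) :
    (∀ t ∈ Set.Ico a b, |e t| ≤ J t) ∧ |eL b| ≤ JL b := by
  rw [abs_le'] at h0
  have hupper := F.le_of_hasFlowOn hab he hJ (fun _ _ => le_rfl) (fun _ _ => le_rfl) h0.1
  have hlower := F.le_of_hasFlowOn hab he.neg hJ (fun t _ => (F.Abar.mulVec_neg (e t)).ge)
    (fun _ _ => le_rfl) h0.2
  exact ⟨fun t ht => abs_le'.2 ⟨hupper.1 t ht, hlower.1 t ht⟩, abs_le'.2 ⟨hupper.2, hlower.2⟩⟩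

end Comparison

end JordanShape

/-! ### The time-varying transformation -/

namespace JordanShape

section Transformation

variable {p : ℕ} (F : JordanShape p)

theorem d_eq_zero_and_cell_eq_one_or_cell_eq_two (r : Fin p) :
    (F.d r = 0 ∧ F.cell r = 1) ∨ F.cell r = 2 := by
  by_cases h : F.d r = 0
  · exact Or.inl ⟨h, if_pos h⟩
  · exact Or.inr (if_neg h)

theorem rot_mul_rot_neg (t : ℝ) (r : Fin p) : F.rot t r * F.rot (-t) r = 1 := by
  unfold rot
  have hcell := F.d_eq_zero_and_cell_eq_one_or_cell_eq_two r
  generalize F.cell r = m at hcell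
  rcases hcell with ⟨hd, rfl⟩ | rfl
  · ext i j
    fin_cases i
    fin_cases j
    simp [hd, Matrix.mul_apply]
  · ext i j
    have hsq := Real.sin_sq_add_cos_sq (F.d r * t)
    fin_cases i <;> fin_cases j <;> simp [Matrix.mul_apply] <;> linarith

theorem hasDerivAt_rot (t : ℝ) (r : Fin p) (i j : Fin (F.cell r)) :
    HasDerivAt (fun t => F.rot t r i j) ((F.c r • F.rot t r - F.rot t r * F.D r) i j) t := by
  have hcos : HasDerivAt (fun t => Real.cos (F.d r * t)) (-Real.sin (F.d r * t) * F.d r) t := by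
    simpa using ((hasDerivAt_id t).const_mul (F.d r)).cos
  have hsin : HasDerivAt (fun t => Real.sin (F.d r * t)) (Real.cos (F.d r * t) * F.d r) t := by
    simpa using ((hasDerivAt_id t).const_mul (F.d r)).sin
  revert i j
  unfold rot D
  have hcell := F.d_eq_zero_and_cell_eq_one_or_cell_eq_two r
  generalize F.cell r = m at hcell
  rcases hcell with ⟨hd, rfl⟩ | rfl
  · intro i j
    fin_cases i
    fin_cases j
    simpa [hd, Matrix.mul_apply] using hasDerivAt_const t (1 : ℝ)
  · intro i j
    fin_cases i <;> fin_cases j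
    · convert hcos using 1 <;> simp [Matrix.mul_apply]; ring
    · convert hsin using 1 <;> simp [Matrix.mul_apply]; ring
    · refine (hsin.fun_neg.congr_deriv ?_).congr_of_eventuallyEq (.of_forall fun t => ?_) <;>
        simp [Matrix.mul_apply]
      ring
    · convert hcos using 1 <;> simp [Matrix.mul_apply]; ring

theorem abs_rot_le (t : ℝ) (r : Fin p) (i j : Fin (F.cell r)) : |F.rot t r i j| ≤ 1 := by
  rw [rot, Matrix.of_apply]
  split_ifs
  · exact Real.abs_cos_le_one _
  · exact Real.abs_sin_le_one _
  · rw [abs_neg]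
    exact Real.abs_sin_le_one _

theorem E_mul_E_neg (t : ℝ) : F.E t * F.E (-t) = 1 := by
  rw [E, E, ← Matrix.blockDiagonal'_mul]
  simp only [← Matrix.mul_kronecker_mul, rot_mul_rot_neg, mul_one, Matrix.one_kronecker_one]
  exact Matrix.blockDiagonal'_one

theorem E_inv (t : ℝ) : (F.E t)⁻¹ = F.E (-t) := Matrix.inv_eq_right_inv (F.E_mul_E_neg t)

theorem E_neg_mul_E (t : ℝ) : F.E (-t) * F.E t = 1 := by
  simpa using F.E_mul_E_neg (-t)

theorem Abar_mul_E_sub_E_mul_Atilde (t : ℝ) :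
    F.Abar * F.E t - F.E t * F.Atilde = Matrix.blockDiagonal' fun r =>
      (1 : Matrix (Fin (F.n r)) (Fin (F.n r)) ℝ) ⊗ₖ (F.c r • F.rot t r - F.rot t r * F.D r) := by
  rw [Abar, E, Atilde, ← Matrix.blockDiagonal'_mul, ← Matrix.blockDiagonal'_mul,
    ← Matrix.blockDiagonal'_sub]
  congr 1
  funext r
  rw [Pi.sub_apply, Matrix.mul_add, ← Matrix.mul_kronecker_mul, ← Matrix.mul_kronecker_mul,
    ← Matrix.mul_kronecker_mul, mul_one, one_mul, one_mul, one_mul, mul_one]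
  ext ⟨i, s⟩ ⟨i', s'⟩
  simp only [Matrix.sub_apply, Matrix.add_apply, Matrix.smul_apply, Matrix.kronecker_apply,
    smul_eq_mul]
  ring

theorem hasDerivAt_E (t : ℝ) (l m : F.Coord) :
    HasDerivAt (fun t => F.E t l m) ((F.Abar * F.E t - F.E t * F.Atilde) l m) t := by
  rw [Abar_mul_E_sub_E_mul_Atilde]
  obtain ⟨r, i, s⟩ := l
  obtain ⟨r', i', s'⟩ := m
  by_cases hr : r = r'
  · subst hr
    simp only [E, Matrix.blockDiagonal'_apply_eq, Matrix.kronecker_apply]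
    exact (F.hasDerivAt_rot t r s s').const_mul _
  · simp only [E, Matrix.blockDiagonal'_apply_ne _ _ _ hr]
    exact hasDerivAt_const _ _

theorem abs_E_le (t : ℝ) (l m : F.Coord) : |F.E t l m| ≤ 1 := by
  obtain ⟨r, i, s⟩ := l
  obtain ⟨r', i', s'⟩ := m
  by_cases hr : r = r'
  · subst hr
    simp only [E, Matrix.blockDiagonal'_apply_eq, Matrix.kronecker_apply, abs_mul]
    refine mul_le_one₀ ?_ (abs_nonneg _) (F.abs_rot_le t r s s')
    rw [Matrix.one_apply]
    split_ifs <;> simp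
  · simp [E, Matrix.blockDiagonal'_apply_ne _ _ _ hr]

open scoped Matrix.Norms.Operator in
theorem norm_E_le (t : ℝ) : ‖F.E t‖ ≤ Fintype.card F.Coord := by
  rw [Matrix.linfty_opNorm_def, ← NNReal.coe_natCast, NNReal.coe_le_coe]
  refine Finset.sup_le fun l _ => ?_
  have hentry : ∀ m ∈ Finset.univ, ‖F.E t l m‖₊ ≤ 1 := fun m _ => F.abs_E_le t l m
  simpa using Finset.sum_le_card_nsmul _ _ _ hentry

variable {F} {nx : ℕ} {A : Matrix (Fin nx) (Fin nx) ℝ} {S : Matrix F.Coord (Fin nx) ℝ}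
  {x : ℝ → Fin nx → ℝ} {s : Set ℝ}

theorem xbar_apply (t : ℝ) (l : F.Coord) : xbar F S x t l = ∑ m, F.E t l m * (S *ᵥ x t) m := by
  rw [xbar, ← Matrix.mulVec_mulVec, Matrix.mulVec, dotProduct]

theorem hasDerivWithinAt_xbar (hSA : S * A = F.Atilde * S) {b : Fin nx → ℝ} {t : ℝ}
    (hx : HasDerivWithinAt x (A *ᵥ x t + b) s t) :
    HasDerivWithinAt (xbar F S x) (F.Abar *ᵥ xbar F S x t + (F.E t * S) *ᵥ b) s t := by
  have hSx : HasDerivWithinAt (fun t => S *ᵥ x t) (S *ᵥ (A *ᵥ x t + b)) s t :=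
    (LinearMap.toContinuousLinearMap S.mulVecLin).hasFDerivAt.comp_hasDerivWithinAt t hx
  have hderiv : F.Abar *ᵥ xbar F S x t + (F.E t * S) *ᵥ b =
      (F.Abar * F.E t - F.E t * F.Atilde) *ᵥ (S *ᵥ x t) + F.E t *ᵥ (S *ᵥ (A *ᵥ x t + b)) := by
    rw [Matrix.mulVec_add S, Matrix.mulVec_mulVec (x t) S A, hSA, Matrix.sub_mulVec,
      Matrix.mulVec_add, xbar]
    simp only [← Matrix.mulVec_mulVec]
    abel
  rw [hderiv]
  refine hasDerivWithinAt_pi.2 fun l => ?_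
  simp only [xbar_apply]
  exact (HasDerivWithinAt.fun_sum fun m _ => (F.hasDerivAt_E t l m).hasDerivWithinAt.mul
    (hasDerivWithinAt_pi.1 hSx m)).congr_deriv Finset.sum_add_distrib

theorem continuousOn_xbar (hx : ContinuousOn x s) : ContinuousOn (xbar F S x) s := by
  refine continuousOn_pi.2 fun l => ?_
  simp only [xbar_apply]
  exact continuousOn_finsetSum _ fun m _ => ContinuousOn.mul
    (fun t _ => (F.hasDerivAt_E t l m).continuousAt.continuousWithinAt)
    ((continuous_apply m).comp_continuousOn
      ((Continuous.matrix_mulVec continuous_const continuous_id).comp_continuousOn hx))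

end Transformation

end JordanShape

/-! ### Error and quantization range -/

theorem exists_mem_Ico_attemptTime {Δ t : ℝ} (hΔ : 0 < Δ) (ht : 0 ≤ t) :
    ∃ k : ℕ, t ∈ Set.Ico (k * Δ) ((k + 1 : ℕ) * Δ) := by
  refine ⟨⌊t / Δ⌋₊, (le_div_iff₀ hΔ).1 (Nat.floor_le (by positivity)), ?_⟩
  rw [← div_lt_iff₀ hΔ, Nat.cast_add_one]
  exact Nat.lt_floor_add_one _

/-- The vector `M_r ε^i e^{(c_r + ε) t}` at cell `i` of block `r`. The weights `ε^i` turn the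
off-diagonal ones of `Ā` into an increase of the growth rate by `ε`. -/
def rangeMajorant {p : ℕ} (F : JordanShape p) (M : Fin p → ℝ) (ε t : ℝ) : F.Coord → ℝ :=
  fun l => M l.1 * ε ^ (l.2.1 : ℕ) * Real.exp ((F.c l.1 + ε) * t)

section Majorant

variable {p : ℕ} {F : JordanShape p} {M : Fin p → ℝ} {ε : ℝ}

theorem hasDerivAt_rangeMajorant (t : ℝ) :
    HasDerivAt (rangeMajorant F M ε) (fun l => (F.c l.1 + ε) * rangeMajorant F M ε t l) t := by
  refine hasDerivAt_pi.2 fun l => ?_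
  have hexp : HasDerivAt (fun t => Real.exp ((F.c l.1 + ε) * t))
      (Real.exp ((F.c l.1 + ε) * t) * (F.c l.1 + ε)) t := by
    simpa using ((hasDerivAt_id t).const_mul (F.c l.1 + ε)).exp
  refine (hexp.const_mul (M l.1 * ε ^ (l.2.1 : ℕ))).congr_deriv ?_
  rw [rangeMajorant]
  ring

theorem Abar_mulVec_rangeMajorant_le (hε : 0 ≤ ε) (hM : 0 ≤ M) (t : ℝ) :
    F.Abar *ᵥ rangeMajorant F M ε t ≤ fun l => (F.c l.1 + ε) * rangeMajorant F M ε t l := by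
  rintro ⟨r, i, s⟩
  have hMr : 0 ≤ M r := hM r
  rw [F.Abar_mulVec_apply]
  simp only [add_mul, rangeMajorant]
  gcongr
  split_ifs
  · rw [pow_succ]
    exact le_of_eq (by ring)
  · positivity

theorem hasFlowOn_rangeMajorant (a b : ℝ) :
    HasFlowOn (rangeMajorant F M ε) (fun t l => (F.c l.1 + ε) * rangeMajorant F M ε t l)
      (rangeMajorant F M ε) a b :=
  .of_hasDerivWithinAt (fun t _ => (hasDerivAt_rangeMajorant t).hasDerivWithinAt)
    fun t _ => (hasDerivAt_rangeMajorant t).continuousAt.continuousWithinAt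

end Majorant

namespace IsClosedLoop

variable {nx nu p : ℕ} {A : Matrix (Fin nx) (Fin nx) ℝ} {B : Matrix (Fin nx) (Fin nu) ℝ}
  {K : Matrix (Fin nu) (Fin nx) ℝ} {F : JordanShape p} {S : Matrix F.Coord (Fin nx) ℝ}
  {Sinv : Matrix (Fin nx) F.Coord ℝ} {dos : DoS} {Δ : ℝ} {bits : Fin p → ℕ → ℕ}
  {x : ℝ → Fin nx → ℝ} {xhat xhatL J JL : ℝ → F.Coord → ℝ}

theorem eq_left_of_mem_Ioo (h : IsClosedLoop A B K F S Sinv dos Δ bits x xhat xhatL J JL)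
    (hΔ : 0 < Δ) {k : ℕ} {t : ℝ} (ht : t ∈ Set.Ioo (k * Δ) ((k + 1 : ℕ) * Δ)) :
    xhat t = xhatL t ∧ J t = JL t := by
  have hk : 0 ≤ k * Δ := by positivity
  refine h.no_jump t (hk.trans ht.1.le) ?_
  rintro j - rfl
  have hkj : k < j := by exact_mod_cast lt_of_mul_lt_mul_right ht.1 hΔ.le
  have hjk : j < k + 1 := by exact_mod_cast lt_of_mul_lt_mul_right ht.2 hΔ.le
  lia

theorem hasFlowOn_range (h : IsClosedLoop A B K F S Sinv dos Δ bits x xhat xhatL J JL)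
    (hΔ : 0 < Δ) (k : ℕ) :
    HasFlowOn J (fun t => F.Abar *ᵥ J t) JL (k * Δ) ((k + 1 : ℕ) * Δ) := by
  have hk : 0 ≤ k * Δ := by positivity
  exact ⟨fun t ht => h.J_flow t (hk.trans ht.1), fun t ht => h.J_left t (hk.trans_lt ht.1),
    fun t ht => (h.eq_left_of_mem_Ioo hΔ ht).2⟩

theorem hasFlowOn_predictor (h : IsClosedLoop A B K F S Sinv dos Δ bits x xhat xhatL J JL)
    (hΔ : 0 < Δ) (k : ℕ) :
    HasFlowOn xhat
      (fun t => F.Abar *ᵥ xhat t + (F.E t * S * B) *ᵥ controlInput K F Sinv xhat t) xhatL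
      (k * Δ) ((k + 1 : ℕ) * Δ) := by
  have hk : 0 ≤ k * Δ := by positivity
  exact ⟨fun t ht => h.xhat_flow t (hk.trans ht.1), fun t ht => h.xhat_left t (hk.trans_lt ht.1),
    fun t ht => (h.eq_left_of_mem_Ioo hΔ ht).1⟩

theorem hasFlowOn_error (h : IsClosedLoop A B K F S Sinv dos Δ bits x xhat xhatL J JL)
    (hΔ : 0 < Δ) (hSA : S * A = F.Atilde * S) (k : ℕ) :
    HasFlowOn (xhat - xbar F S x) (fun t => F.Abar *ᵥ (xhat - xbar F S x) t)
      (xhatL - xbar F S x) (k * Δ) ((k + 1 : ℕ) * Δ) := by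
  have hk : 0 ≤ k * Δ := by positivity
  have hxbar : HasFlowOn (xbar F S x) (fun t => F.Abar *ᵥ xbar F S x t +
      (F.E t * S * B) *ᵥ controlInput K F Sinv xhat t) (xbar F S x) (k * Δ) ((k + 1 : ℕ) * Δ) := by
    refine .of_hasDerivWithinAt (fun t ht => ?_)
      ((JordanShape.continuousOn_xbar h.x_cont).mono fun t ht => hk.trans ht.1.le)
    rw [← Matrix.mulVec_mulVec]
    exact JordanShape.hasDerivWithinAt_xbar hSA (h.x_flow t (hk.trans ht.1))
  convert (h.hasFlowOn_predictor hΔ k).sub hxbar using 2 with t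
  simp [Matrix.mulVec_sub]

theorem eq_left_of_not_success (h : IsClosedLoop A B K F S Sinv dos Δ bits x xhat xhatL J JL)
    (hΔ : 0 < Δ) {k : ℕ} (hk : ¬dos.Success Δ k) :
    xhat (k * Δ) = xhatL (k * Δ) ∧ J (k * Δ) = JL (k * Δ) := by
  refine h.no_jump (k * Δ) (by positivity) fun j hj hkj => ?_
  have hkj' : k = j := by exact_mod_cast mul_right_cancel₀ hΔ.ne' hkj
  exact hk (hkj' ▸ hj)

theorem range_eq_inv_pow_mul_left (h : IsClosedLoop A B K F S Sinv dos Δ bits x xhat xhatL J JL)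
    (hΔ : 0 < Δ) (k : ℕ) (l : F.Coord) :
    J (k * Δ) l = ((2 : ℝ) ^ receivedBits dos Δ (bits l.1) k)⁻¹ * JL (k * Δ) l := by
  rw [receivedBits]
  split_ifs with hk
  · exact h.J_jump k hk l
  · simp [(h.eq_left_of_not_success hΔ hk).2]

theorem abs_error_le_range_of_left
    (h : IsClosedLoop A B K F S Sinv dos Δ bits x xhat xhatL J JL) (hΔ : 0 < Δ) {k : ℕ}
    (hleft : |(xhatL - xbar F S x) (k * Δ)| ≤ JL (k * Δ)) :
    |(xhat - xbar F S x) (k * Δ)| ≤ J (k * Δ) := by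
  by_cases hk : dos.Success Δ k
  · intro l
    rw [Pi.abs_apply, Pi.sub_apply, Pi.sub_apply, h.J_jump k hk l, h.xhat_jump k hk l,
      sub_right_comm]
    exact abs_sub_mul_quantizer_le _ (hleft l)
  · obtain ⟨hxhat, hJ⟩ := h.eq_left_of_not_success hΔ hk
    rwa [Pi.sub_apply, hxhat, hJ]

theorem abs_error_le_range (h : IsClosedLoop A B K F S Sinv dos Δ bits x xhat xhatL J JL)
    (hΔ : 0 < Δ) (hSA : S * A = F.Atilde * S) {t : ℝ} (ht : 0 ≤ t) :
    |(xhat - xbar F S x) t| ≤ J t := by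
  have hflow : ∀ k : ℕ, |(xhat - xbar F S x) (k * Δ)| ≤ J (k * Δ) → _ := fun k =>
    F.abs_le_of_hasFlowOn (by gcongr; exact k.lt_succ_self) (h.hasFlowOn_error hΔ hSA k)
      (h.hasFlowOn_range hΔ k)
  have hattempt : ∀ k : ℕ, |(xhat - xbar F S x) (k * Δ)| ≤ J (k * Δ) := by
    intro k
    induction k with
    | zero =>
      refine h.abs_error_le_range_of_left hΔ fun l => ?_
      simpa [h.xhat_init] using (h.J_init l).le
    | succ k ih => exact h.abs_error_le_range_of_left hΔ (hflow k ih).2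
  obtain ⟨k, hk⟩ := exists_mem_Ico_attemptTime hΔ ht
  exact (hflow k (hattempt k)).1 t hk

theorem range_le_rangeMajorant (h : IsClosedLoop A B K F S Sinv dos Δ bits x xhat xhatL J JL)
    (hΔ : 0 < Δ) {M : Fin p → ℝ} {ε : ℝ} (hε : 0 ≤ ε) (hM : 0 ≤ M)
    (h0 : JL 0 ≤ rangeMajorant F M ε 0) (k : ℕ) :
    ∀ t ∈ Set.Ico (k * Δ) ((k + 1 : ℕ) * Δ), J t ≤
      rangeMajorant F (fun r => ((2 : ℝ) ^ totalBits dos Δ (bits r) k)⁻¹ * M r) ε t := by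
  set U : ℕ → ℝ → F.Coord → ℝ := fun k =>
    rangeMajorant F (fun r => ((2 : ℝ) ^ totalBits dos Δ (bits r) k)⁻¹ * M r) ε
  have hflow : ∀ k : ℕ, J (k * Δ) ≤ U k (k * Δ) → _ := fun k =>
    F.le_of_hasFlowOn (by gcongr; exact k.lt_succ_self) (h.hasFlowOn_range hΔ k)
      (hasFlowOn_rangeMajorant _ _) (fun _ _ => le_rfl)
      (fun t _ => Abar_mulVec_rangeMajorant_le hε
        (fun r => mul_nonneg (by positivity) (hM r)) t)
  have hattempt : ∀ k : ℕ, J (k * Δ) ≤ U k (k * Δ) := by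
    intro k
    induction k with
    | zero =>
      intro l
      rw [h.range_eq_inv_pow_mul_left hΔ]
      simp only [U, rangeMajorant, totalBits, zero_add, Finset.sum_range_one, mul_assoc,
        Nat.cast_zero, zero_mul]
      gcongr
      simpa only [rangeMajorant, mul_assoc] using h0 l
    | succ k ih =>
      intro l
      rw [h.range_eq_inv_pow_mul_left hΔ]
      simp only [U, rangeMajorant, totalBits, Finset.sum_range_succ _ (k + 1), pow_add, mul_inv_rev,
        mul_assoc]
      gcongr
      simpa only [U, rangeMajorant, totalBits, mul_assoc] using (hflow k ih).2 l
  exact (hflow k (hattempt k)).1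

end IsClosedLoop

theorem exists_pos_forall_lt {ι : Type*} [Finite ι] {μ : ι → ℝ} (hμ : ∀ i, 0 < μ i) :
    ∃ ε > 0, ∀ i, ε < μ i := by
  have hev : ∀ᶠ ε in 𝓝[>] (0 : ℝ), ∀ i, ε < μ i :=
    eventually_all.2 fun i => (eventually_lt_nhds (hμ i)).filter_mono nhdsWithin_le_nhds
  obtain ⟨ε, hlt, hε⟩ := (hev.and self_mem_nhdsWithin).exists
  exact ⟨ε, hε, hlt⟩

/-! ### Exponential decay of Hurwitz flows -/

theorem norm_le_add_of_norm_deriv_right_le_exp {V : Type*} [NormedAddCommGroup V] [NormedSpace ℝ V]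
    {f f' : ℝ → V} {C β t : ℝ} (hβ : 0 < β) (hC : 0 ≤ C) (ht : 0 ≤ t)
    (hf : ContinuousOn f (Set.Icc 0 t))
    (hf' : ∀ s ∈ Set.Ico 0 t, HasDerivWithinAt f (f' s) (Set.Ici s) s)
    (hbound : ∀ s ∈ Set.Ico 0 t, ‖f' s‖ ≤ C * Real.exp (β * s)) :
    ‖f t‖ ≤ ‖f 0‖ + C / β * Real.exp (β * t) := by
  have hB : ∀ s : ℝ, HasDerivAt (fun s : ℝ => ‖f 0‖ + C / β * Real.exp (β * s))
      (C * Real.exp (β * s)) s := fun s => by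
    have hexp : HasDerivAt (fun s : ℝ => Real.exp (β * s)) (Real.exp (β * s) * β) s := by
      simpa using ((hasDerivAt_id s).const_mul β).exp
    refine ((hexp.const_mul (C / β)).const_add ‖f 0‖).congr_deriv ?_
    field_simp
  exact image_norm_le_of_norm_deriv_right_le_deriv_boundary hf hf'
    (B := fun s : ℝ => ‖f 0‖ + C / β * Real.exp (β * s))
    (le_add_of_nonneg_right (by positivity)) hB hbound (Set.right_mem_Icc.2 ht)

section HurwitzFlow

variable {V : Type*} [NormedAddCommGroup V] [NormedSpace ℂ V] [CompleteSpace V] {T : V →L[ℂ] V}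

theorem hasDerivAt_exp_ofReal_smul (T : V →L[ℂ] V) (t : ℝ) :
    HasDerivAt (fun t : ℝ => NormedSpace.exp ((t : ℂ) • T))
      (NormedSpace.exp ((t : ℂ) • T) * T) t := by
  have hexp := (hasDerivAt_exp_smul_const T (t : ℂ)).scomp t Complex.ofRealCLM.hasDerivAt
  rwa [Complex.ofRealCLM_apply, Complex.ofReal_one, one_smul] at hexp

theorem hasDerivAt_exp_ofReal_smul_apply (T : V →L[ℂ] V) (v : V) (t : ℝ) :
    HasDerivAt (fun t : ℝ => NormedSpace.exp ((t : ℂ) • T) v)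
      (NormedSpace.exp ((t : ℂ) • T) (T v)) t :=
  ((ContinuousLinearMap.apply ℂ V v).restrictScalars ℝ).hasFDerivAt.comp_hasDerivAt t
    (hasDerivAt_exp_ofReal_smul T t)

theorem hasDerivAt_cexp_neg_smul_exp_apply (T : V →L[ℂ] V) (μ : ℂ) (v : V) (t : ℝ) :
    HasDerivAt (fun t : ℝ => Complex.exp (-μ * t) • NormedSpace.exp ((t : ℂ) • T) v)
      (Complex.exp (-μ * t) • NormedSpace.exp ((t : ℂ) • T) (T v - μ • v)) t := by
  have hexp : HasDerivAt (fun s : ℂ => Complex.exp (-μ * s)) (Complex.exp (-μ * t) * -μ) t := by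
    simpa using ((hasDerivAt_id (t : ℂ)).const_mul (-μ)).cexp
  refine (hexp.comp_ofReal.smul (hasDerivAt_exp_ofReal_smul_apply T v t)).congr_deriv ?_
  rw [map_sub, map_smul, smul_sub, smul_smul, mul_neg, neg_smul]
  abel

theorem norm_exp_smul_apply_le_of_sub_smul {μ : ℂ} {α C : ℝ} (hα : μ.re < α) {v : V}
    (hC : ∀ t : ℝ, 0 ≤ t →
      ‖NormedSpace.exp ((t : ℂ) • T) (T v - μ • v)‖ ≤ C * Real.exp (α * t))
    {t : ℝ} (ht : 0 ≤ t) :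
    ‖NormedSpace.exp ((t : ℂ) • T) v‖ ≤ (‖v‖ + C / (α - μ.re)) * Real.exp (α * t) := by
  have hC0 : 0 ≤ C := by simpa using (norm_nonneg _).trans (hC 0 le_rfl)
  have hnorm : ∀ s : ℝ, ‖Complex.exp (-μ * s)‖ = Real.exp (-μ.re * s) := fun s => by
    simp [Complex.norm_exp]
  have hrescaled := norm_le_add_of_norm_deriv_right_le_exp (sub_pos.2 hα) hC0 ht
    (fun s _ => (hasDerivAt_cexp_neg_smul_exp_apply T μ v s).continuousAt.continuousWithinAt)
    (fun s _ => (hasDerivAt_cexp_neg_smul_exp_apply T μ v s).hasDerivWithinAt) (fun s hs => by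
      rw [norm_smul, hnorm]
      calc Real.exp (-μ.re * s) * _ ≤ Real.exp (-μ.re * s) * (C * Real.exp (α * s)) := by
            gcongr
            exact hC s hs.1
        _ = C * Real.exp ((α - μ.re) * s) := by
            rw [mul_left_comm, ← Real.exp_add]
            ring_nf)
  simp only [norm_smul, hnorm, Complex.ofReal_zero, mul_zero, Complex.exp_zero, norm_one,
    one_mul, zero_smul, NormedSpace.exp_zero, one_apply_eq_self] at hrescaled
  calc ‖NormedSpace.exp ((t : ℂ) • T) v‖
      = Real.exp (μ.re * t) * (Real.exp (-μ.re * t) * ‖NormedSpace.exp ((t : ℂ) • T) v‖) := by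
        rw [← mul_assoc, ← Real.exp_add]
        simp
    _ ≤ Real.exp (μ.re * t) * (‖v‖ + C / (α - μ.re) * Real.exp ((α - μ.re) * t)) := by gcongr
    _ = ‖v‖ * Real.exp (μ.re * t) + C / (α - μ.re) * Real.exp (α * t) := by
        rw [mul_add, mul_left_comm, ← Real.exp_add]
        ring_nf
    _ ≤ ‖v‖ * Real.exp (α * t) + C / (α - μ.re) * Real.exp (α * t) := by gcongr
    _ = (‖v‖ + C / (α - μ.re)) * Real.exp (α * t) := by ring

theorem exists_norm_exp_smul_apply_le_of_pow_apply_eq_zero {μ : ℂ} {α : ℝ} (hα : μ.re < α)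
    (k : ℕ) (v : V) (hv : (((T : Module.End ℂ V) - μ • 1) ^ k) v = 0) :
    ∃ C : ℝ, ∀ t : ℝ, 0 ≤ t → ‖NormedSpace.exp ((t : ℂ) • T) v‖ ≤ C * Real.exp (α * t) := by
  induction k generalizing v with
  | zero => exact ⟨0, fun t _ => by simp [show v = 0 by simpa using hv]⟩
  | succ k ih =>
    rw [pow_succ, Module.End.mul_apply] at hv
    obtain ⟨C, hC⟩ := ih (T v - μ • v) hv
    exact ⟨_, fun t ht => norm_exp_smul_apply_le_of_sub_smul hα hC ht⟩

theorem exists_norm_exp_smul_apply_le [FiniteDimensional ℂ V] {α : ℝ}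
    (hα : ∀ μ ∈ spectrum ℂ (T : Module.End ℂ V), μ.re < α) (v : V) :
    ∃ C : ℝ, ∀ t : ℝ, 0 ≤ t → ‖NormedSpace.exp ((t : ℂ) • T) v‖ ≤ C * Real.exp (α * t) := by
  have hv : v ∈ ⨆ μ, Module.End.maxGenEigenspace (T : Module.End ℂ V) μ := by
    rw [Module.End.iSup_maxGenEigenspace_eq_top]
    exact Submodule.mem_top
  induction hv using Submodule.iSup_induction' with
  | mem μ u hu =>
    obtain ⟨k, hk⟩ := (Module.End.mem_maxGenEigenspace _ _ _).1 hu
    rcases eq_or_ne u 0 with rfl | hu0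
    · exact ⟨0, fun t _ => by simp⟩
    · have hne : Module.End.genEigenspace (T : Module.End ℂ V) μ k ≠ ⊥ :=
        (Submodule.ne_bot_iff _).2 ⟨u, Module.End.mem_genEigenspace_nat.2 hk, hu0⟩
      have hμ := (Module.End.hasEigenvalue_of_hasGenEigenvalue hne).mem_spectrum
      exact exists_norm_exp_smul_apply_le_of_pow_apply_eq_zero (hα μ hμ) k u hk
  | zero => exact ⟨0, fun t _ => by simp⟩
  | add u u' _ _ hu hu' =>
    obtain ⟨C, hC⟩ := hu
    obtain ⟨C', hC'⟩ := hu'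
    refine ⟨C + C', fun t ht => ?_⟩
    rw [map_add, add_mul]
    exact (norm_add_le _ _).trans (add_le_add (hC t ht) (hC' t ht))

theorem exists_norm_exp_smul_le [FiniteDimensional ℂ V] {α : ℝ}
    (hα : ∀ μ ∈ spectrum ℂ (T : Module.End ℂ V), μ.re < α) :
    ∃ C : ℝ, 0 < C ∧ ∀ t : ℝ, 0 ≤ t → ‖NormedSpace.exp ((t : ℂ) • T)‖ ≤ C * Real.exp (α * t) := by
  have hscaled : ∀ (t : ℝ) (W : V →L[ℂ] V), ‖(Real.exp (-α * t) : ℂ) • W‖ =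
      ‖W‖ / Real.exp (α * t) := fun t W => by
    rw [norm_smul, Complex.norm_real, Real.norm_eq_abs, Real.abs_exp, neg_mul, Real.exp_neg]
    field_simp
  obtain ⟨C, hC⟩ := banach_steinhaus
    (g := fun t : Set.Ici (0 : ℝ) => (Real.exp (-α * t) : ℂ) • NormedSpace.exp ((t : ℂ) • T))
    fun v => by
      obtain ⟨C, hC⟩ := exists_norm_exp_smul_apply_le hα v
      refine ⟨C, fun t => ?_⟩
      rw [smul_apply, norm_smul, Complex.norm_real, Real.norm_eq_abs,
        Real.abs_exp, neg_mul, Real.exp_neg, inv_mul_le_iff₀' (Real.exp_pos _)]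
      exact hC t t.2
  refine ⟨max C 1, by positivity, fun t ht => ?_⟩
  rw [← div_le_iff₀ (Real.exp_pos _), ← hscaled]
  exact (hC ⟨t, ht⟩).trans (le_max_left _ _)

theorem hasDerivWithinAt_exp_sub_smul_apply {y : ℝ → V} {b : V} {S : Set ℝ} {s : ℝ} (t : ℝ)
    (hy : HasDerivWithinAt y (T (y s) + b) S s) :
    HasDerivWithinAt (fun s : ℝ => NormedSpace.exp (((t - s : ℝ) : ℂ) • T) (y s))
      (NormedSpace.exp (((t - s : ℝ) : ℂ) • T) b) S s := by
  have hexp : HasDerivAt (fun s : ℝ => NormedSpace.exp (((t - s : ℝ) : ℂ) • T))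
      (-(NormedSpace.exp (((t - s : ℝ) : ℂ) • T) * T)) s :=
    ((hasDerivAt_exp_ofReal_smul T (t - s)).scomp s ((hasDerivAt_id s).const_sub t)).congr_deriv
      (neg_one_smul ℝ _)
  have hexp' : HasDerivAt
      (fun s : ℝ => (NormedSpace.exp (((t - s : ℝ) : ℂ) • T)).restrictScalars ℝ)
      ((-(NormedSpace.exp (((t - s : ℝ) : ℂ) • T) * T)).restrictScalars ℝ) s :=
    (ContinuousLinearMap.restrictScalarsL ℂ V V ℝ ℝ).hasFDerivAt.comp_hasDerivAt s hexp
  exact (hexp'.hasDerivWithinAt.clm_apply hy).congr_deriv (by simp)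

theorem norm_le_of_norm_exp_smul_le {C a δ G : ℝ} {y g : ℝ → V}
    (hC : ∀ t : ℝ, 0 ≤ t → ‖NormedSpace.exp ((t : ℂ) • T)‖ ≤ C * Real.exp (-a * t)) (hδ : δ < a)
    (hy : ContinuousOn y (Set.Ici 0))
    (hy' : ∀ t, 0 ≤ t → HasDerivWithinAt y (T (y t) + g t) (Set.Ici t) t)
    (hg : ∀ t, 0 ≤ t → ‖g t‖ ≤ G * Real.exp (-δ * t)) {t : ℝ} (ht : 0 ≤ t) :
    ‖y t‖ ≤ C * (‖y 0‖ + G / (a - δ)) * Real.exp (-δ * t) := by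
  have hC0 : 0 ≤ C := by simpa using (norm_nonneg _).trans (hC 0 le_rfl)
  have hG0 : 0 ≤ G := by simpa using (norm_nonneg _).trans (hg 0 le_rfl)
  have hδ' : 0 < a - δ := sub_pos.2 hδ
  have hbound : ∀ s ≤ t, ∀ v, ‖NormedSpace.exp (((t - s : ℝ) : ℂ) • T) v‖ ≤
      C * Real.exp (-a * (t - s)) * ‖v‖ := fun s hs v =>
    ContinuousLinearMap.le_of_opNorm_le _ (hC _ (sub_nonneg.2 hs)) v
  have hcont : Continuous fun s : ℝ => NormedSpace.exp (((t - s : ℝ) : ℂ) • T) :=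
    (continuous_iff_continuousAt.2 fun s => (hasDerivAt_exp_ofReal_smul T s).continuousAt).comp
      (continuous_const.sub continuous_id)
  have hduhamel := norm_le_add_of_norm_deriv_right_le_exp (C := C * G * Real.exp (-a * t)) hδ'
    (by positivity) ht (f := fun s => NormedSpace.exp (((t - s : ℝ) : ℂ) • T) (y s))
    (f' := fun s => NormedSpace.exp (((t - s : ℝ) : ℂ) • T) (g s))
    (hcont.continuousOn.clm_apply (hy.mono Set.Icc_subset_Ici_self))
    (fun s hs => hasDerivWithinAt_exp_sub_smul_apply t (hy' s hs.1)) (fun s hs => by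
      calc _ ≤ C * Real.exp (-a * (t - s)) * (G * Real.exp (-δ * s)) := by
            refine (hbound s hs.2.le _).trans ?_
            gcongr
            exact hg s hs.1
        _ = C * G * (Real.exp (-a * (t - s)) * Real.exp (-δ * s)) := by ring
        _ = C * G * Real.exp (-a * t) * Real.exp ((a - δ) * s) := by
            rw [mul_assoc _ (Real.exp _), ← Real.exp_add, ← Real.exp_add]
            ring_nf)
  simp only [sub_self, sub_zero, Complex.ofReal_zero, zero_smul, NormedSpace.exp_zero,
    one_apply_eq_self] at hduhamel
  calc ‖y t‖ ≤ C * Real.exp (-a * t) * ‖y 0‖ +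
        C * G * Real.exp (-a * t) / (a - δ) * Real.exp ((a - δ) * t) := by
        refine hduhamel.trans ?_
        gcongr
        simpa using hbound 0 ht (y 0)
    _ = C * Real.exp (-a * t) * ‖y 0‖ + C * G / (a - δ) * Real.exp (-δ * t) := by
        have hsplit : Real.exp (-δ * t) = Real.exp (-a * t) * Real.exp ((a - δ) * t) := by
          rw [← Real.exp_add]
          ring_nf
        rw [hsplit]
        ring
    _ ≤ C * Real.exp (-δ * t) * ‖y 0‖ + C * G / (a - δ) * Real.exp (-δ * t) := by gcongr
    _ = C * (‖y 0‖ + G / (a - δ)) * Real.exp (-δ * t) := by ring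

end HurwitzFlow

/-- The inclusion of `ℝⁿ` into `ℂⁿ`. -/
def complexify (n : ℕ) : (Fin n → ℝ) →L[ℝ] (Fin n → ℂ) :=
  ContinuousLinearMap.pi fun i => Complex.ofRealCLM.comp (ContinuousLinearMap.proj i)

theorem norm_complexify {n : ℕ} (v : Fin n → ℝ) : ‖complexify n v‖ = ‖v‖ := by
  simp [complexify, Pi.norm_def]

theorem complexify_mulVec {n : ℕ} (M : Matrix (Fin n) (Fin n) ℝ) (v : Fin n → ℝ) :
    complexify n (M *ᵥ v) = M.map (algebraMap ℝ ℂ) *ᵥ complexify n v := by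
  ext i
  simp [complexify, Matrix.mulVec, dotProduct]

theorem IsHurwitz.exists_rate {n : ℕ} {M : Matrix (Fin n) (Fin n) ℝ} (hM : IsHurwitz M) :
    ∃ a : ℝ, 0 < a ∧ ∀ μ ∈ spectrum ℂ (M.map (algebraMap ℝ ℂ)), μ.re < -a := by
  have : Finite (spectrum ℂ (M.map (algebraMap ℝ ℂ))) := Matrix.finite_spectrum _
  obtain ⟨a, ha, hlt⟩ := exists_pos_forall_lt
    (μ := fun μ : spectrum ℂ (M.map (algebraMap ℝ ℂ)) => -μ.1.re) fun μ => neg_pos.2 (hM μ.1 μ.2)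
  exact ⟨a, ha, fun μ hμ => lt_neg.1 (hlt ⟨μ, hμ⟩)⟩

theorem IsHurwitz.exists_norm_le_of_norm_perturbation_le {n : ℕ} {M : Matrix (Fin n) (Fin n) ℝ}
    (hM : IsHurwitz M) :
    ∃ a C : ℝ, 0 < a ∧ 0 < C ∧ ∀ (δ G : ℝ), δ < a → ∀ x g : ℝ → Fin n → ℝ,
      ContinuousOn x (Set.Ici 0) →
      (∀ t, 0 ≤ t → HasDerivWithinAt x (M *ᵥ x t + g t) (Set.Ici t) t) →
      (∀ t, 0 ≤ t → ‖g t‖ ≤ G * Real.exp (-δ * t)) →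
      ∀ t, 0 ≤ t → ‖x t‖ ≤ C * (‖x 0‖ + G / (a - δ)) * Real.exp (-δ * t) := by
  obtain ⟨a, ha, hspec⟩ := hM.exists_rate
  obtain ⟨C, hC, hflow⟩ := exists_norm_exp_smul_le (α := -a)
    (T := LinearMap.toContinuousLinearMap (Matrix.toLin' (M.map (algebraMap ℝ ℂ))))
    fun μ hμ => hspec μ (by rwa [← Matrix.spectrum_toLin'])
  refine ⟨a, C, ha, hC, fun δ G hδ x g hx hx' hg t ht => ?_⟩
  simpa only [Function.comp_apply, norm_complexify] using norm_le_of_norm_exp_smul_le hflow hδ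
    ((complexify n).continuous.comp_continuousOn hx)
    (g := fun t => complexify n (g t)) (fun t ht => by
      refine ((complexify n).hasFDerivAt.comp_hasDerivWithinAt t (hx' t ht)).congr_deriv ?_
      rw [map_add, complexify_mulVec]
      rfl)
    (fun t ht => (norm_complexify (g t)).trans_le (hg t ht)) ht

/-! ### Exponential stability of the closed loop -/

/-- The bits received up to each attempt outweigh the expansion of every block, with room to spare:
even at the growth rates `c_r + ε`, the expansion discounted by the received bits decays like
`C e^{-ε t}` until the next attempt. -/
def BitsOutweighGrowth {p : ℕ} (c : Fin p → ℝ) (dos : DoS) (Δ : ℝ) (bits : Fin p → ℕ → ℕ)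
    (ε C : ℝ) : Prop :=
  ∀ (r : Fin p) (k : ℕ) (t : ℝ), 0 ≤ t → t ≤ (k + 1) * Δ →
    Real.exp ((c r + ε) * t) * ((2 : ℝ) ^ totalBits dos Δ (bits r) k)⁻¹ ≤ C * Real.exp (-ε * t)

theorem exists_bitsOutweighGrowth {p : ℕ} {c w : Fin p → ℝ} {R : Fin p → ℕ} {Δ η τD κ T a : ℝ}
    (hΔ : 0 < Δ) (hκ : 0 ≤ κ) (hT : 0 ≤ T) (hρ : 0 < 1 - 1 / T - Δ / τD)
    (hR : ∀ r, 0 ≤ c r →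
      1 / (1 - 1 / T - Δ / τD) * c r * Δ * Real.logb 2 (Real.exp 1) < (R r : ℝ))
    (hw : ∀ r, c r < w r) (ha : 0 < a) :
    ∃ ε C : ℝ, 0 < ε ∧ ε < a ∧ 0 ≤ C ∧ ∀ dos : DoS, dos.FrequencyBound η τD →
      dos.DurationBound κ T → ∀ bits : Fin p → ℕ → ℕ, FollowsBitProtocol dos Δ c w R bits →
      BitsOutweighGrowth c dos Δ bits ε C := by
  choose C μ hC hμ hgrowth using fun r =>
    exists_exp_mul_inv_pow_totalBits_le (η := η) hΔ hκ hT hρ (hR r) (hw r)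
  obtain ⟨ε', hε', hεμ⟩ := exists_pos_forall_lt (μ := fun r => μ r / 2) fun r => half_pos (hμ r)
  set ε := min ε' (a / 2)
  refine ⟨ε, ∑ r, C r, lt_min hε' (half_pos ha), (min_le_right _ _).trans_lt (half_lt_self ha),
    Finset.sum_nonneg fun r _ => (hC r).le, fun dos hf hd bits hbits r k t ht htk => ?_⟩
  have hrate : ε + -μ r ≤ -ε := by linarith [hεμ r, min_le_left ε' (a / 2)]
  calc Real.exp ((c r + ε) * t) * ((2 : ℝ) ^ totalBits dos Δ (bits r) k)⁻¹
      = Real.exp (ε * t) *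
          (Real.exp (c r * t) * ((2 : ℝ) ^ totalBits dos Δ (bits r) k)⁻¹) := by
        rw [add_comm, add_mul, Real.exp_add, mul_assoc]
    _ ≤ Real.exp (ε * t) * (C r * Real.exp (-μ r * t)) :=
        mul_le_mul_of_nonneg_left (hgrowth r dos hf hd (bits r) (hbits r) k t htk)
          (Real.exp_nonneg _)
    _ = C r * Real.exp ((ε + -μ r) * t) := by rw [mul_left_comm, ← Real.exp_add, ← add_mul]
    _ ≤ (∑ r, C r) * Real.exp (-ε * t) := by
        gcongr
        · exact Finset.sum_nonneg fun r _ => (hC r).le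
        · exact Finset.single_le_sum (fun r _ => (hC r).le) (Finset.mem_univ r)

theorem le_rangeMajorant_zero {p : ℕ} {F : JordanShape p} {ε : ℝ} (hε : 0 < ε) (hε1 : ε ≤ 1)
    (v : F.Coord → ℝ) : v ≤ rangeMajorant F (fun r => ‖v‖ / ε ^ F.n r) ε 0 := by
  intro l
  rw [rangeMajorant, mul_zero, Real.exp_zero, mul_one, div_mul_eq_mul_div,
    le_div_iff₀ (by positivity)]
  exact mul_le_mul ((le_abs_self _).trans (norm_le_pi_norm v l))
    (pow_le_pow_of_le_one hε.le hε1 l.2.1.2.le) (by positivity) (norm_nonneg _)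

theorem mul_eq_mul_of_mul_mul_eq {m n : Type*} [Fintype m] [Fintype n] [DecidableEq n]
    {A : Matrix n n ℝ} {A' : Matrix m m ℝ} {S : Matrix m n ℝ} {Sinv : Matrix n m ℝ}
    (hS : Sinv * S = 1) (hA : S * A * Sinv = A') : S * A = A' * S := by
  rw [← hA, Matrix.mul_assoc _ Sinv, hS, Matrix.mul_one]

namespace IsClosedLoop

variable {nx nu p : ℕ} {A : Matrix (Fin nx) (Fin nx) ℝ} {B : Matrix (Fin nx) (Fin nu) ℝ}
  {K : Matrix (Fin nu) (Fin nx) ℝ} {F : JordanShape p} {S : Matrix F.Coord (Fin nx) ℝ}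
  {Sinv : Matrix (Fin nx) F.Coord ℝ} {dos : DoS} {Δ : ℝ} {bits : Fin p → ℕ → ℕ}
  {x : ℝ → Fin nx → ℝ} {xhat xhatL J JL : ℝ → F.Coord → ℝ}

theorem norm_error_le (h : IsClosedLoop A B K F S Sinv dos Δ bits x xhat xhatL J JL)
    (hΔ : 0 < Δ) (hSA : S * A = F.Atilde * S) {t : ℝ} (ht : 0 ≤ t) :
    ‖xhat t - xbar F S x t‖ ≤ ‖J t‖ :=
  (pi_norm_le_iff_of_nonneg (norm_nonneg _)).2 fun l =>
    (h.abs_error_le_range hΔ hSA ht l).trans ((le_abs_self _).trans (norm_le_pi_norm (J t) l))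

theorem norm_range_le (h : IsClosedLoop A B K F S Sinv dos Δ bits x xhat xhatL J JL)
    (hΔ : 0 < Δ) (hSA : S * A = F.Atilde * S) {ε C : ℝ} (hε : 0 < ε) (hε1 : ε ≤ 1) (hC : 0 ≤ C)
    (hbits : BitsOutweighGrowth F.c dos Δ bits ε C) {t : ℝ} (ht : 0 ≤ t) :
    ‖J t‖ ≤ (∑ r, C / ε ^ F.n r) * ‖JL 0‖ * Real.exp (-ε * t) := by
  obtain ⟨k, hk⟩ := exists_mem_Ico_attemptTime hΔ ht
  have hterm : ∀ r, 0 ≤ C / ε ^ F.n r := fun r => by positivity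
  refine (pi_norm_le_iff_of_nonneg (by positivity)).2 fun l => ?_
  rw [Real.norm_of_nonneg ((abs_nonneg _).trans (h.abs_error_le_range hΔ hSA ht l))]
  calc J t l ≤ ((2 : ℝ) ^ totalBits dos Δ (bits l.1) k)⁻¹ * (‖JL 0‖ / ε ^ F.n l.1) *
        ε ^ (l.2.1 : ℕ) * Real.exp ((F.c l.1 + ε) * t) :=
        h.range_le_rangeMajorant hΔ hε.le (fun r => by positivity)
          (le_rangeMajorant_zero hε hε1 (JL 0)) k t hk l
    _ = ‖JL 0‖ / ε ^ F.n l.1 * ε ^ (l.2.1 : ℕ) * (Real.exp ((F.c l.1 + ε) * t) *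
        ((2 : ℝ) ^ totalBits dos Δ (bits l.1) k)⁻¹) := by ring
    _ ≤ ‖JL 0‖ / ε ^ F.n l.1 * 1 * (C * Real.exp (-ε * t)) := by
        gcongr _ * ?_ * ?_
        · exact pow_le_one₀ hε.le hε1
        · exact hbits l.1 k t ht (by exact_mod_cast hk.2.le)
    _ = C / ε ^ F.n l.1 * ‖JL 0‖ * Real.exp (-ε * t) := by ring
    _ ≤ (∑ r, C / ε ^ F.n r) * ‖JL 0‖ * Real.exp (-ε * t) := by
        gcongr
        exact Finset.single_le_sum (fun r _ => hterm r) (Finset.mem_univ l.1)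

theorem hasDerivWithinAt_state (h : IsClosedLoop A B K F S Sinv dos Δ bits x xhat xhatL J JL)
    (hS : Sinv * S = 1) {t : ℝ} (ht : 0 ≤ t) :
    HasDerivWithinAt x ((A + B * K) *ᵥ x t +
      (B * K * Sinv) *ᵥ (F.E (-t) *ᵥ (xhat t - xbar F S x t))) (Set.Ici t) t := by
  refine (h.x_flow t ht).congr_deriv ?_
  have hx : Sinv *ᵥ (F.E (-t) *ᵥ xbar F S x t) = x t := by
    rw [xbar, Matrix.mulVec_mulVec, Matrix.mulVec_mulVec, Matrix.mul_assoc,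
      ← Matrix.mul_assoc (F.E (-t)), F.E_neg_mul_E, Matrix.one_mul, hS, Matrix.one_mulVec]
  rw [controlInput, F.E_inv, Matrix.mulVec_sub, Matrix.mulVec_sub, Matrix.add_mulVec]
  simp only [← Matrix.mulVec_mulVec, hx]
  abel

open scoped Matrix.Norms.Operator in
theorem norm_predictor_le (h : IsClosedLoop A B K F S Sinv dos Δ bits x xhat xhatL J JL)
    (hΔ : 0 < Δ) (hSA : S * A = F.Atilde * S) {t : ℝ} (ht : 0 ≤ t) :
    ‖xhat t‖ ≤ Fintype.card F.Coord * ‖S‖ * ‖x t‖ + ‖J t‖ := by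
  have hxbar : ‖xbar F S x t‖ ≤ Fintype.card F.Coord * ‖S‖ * ‖x t‖ := by
    refine (Matrix.linfty_opNorm_mulVec _ _).trans ?_
    gcongr
    refine (Matrix.linfty_opNorm_mul _ _).trans ?_
    gcongr
    exact F.norm_E_le t
  calc ‖xhat t‖ = ‖xbar F S x t + (xhat t - xbar F S x t)‖ := by rw [add_sub_cancel]
    _ ≤ Fintype.card F.Coord * ‖S‖ * ‖x t‖ + ‖J t‖ :=
        (norm_add_le _ _).trans (add_le_add hxbar (h.norm_error_le hΔ hSA ht))

open scoped Matrix.Norms.Operator in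
theorem norm_state_perturbation_le
    (h : IsClosedLoop A B K F S Sinv dos Δ bits x xhat xhatL J JL)
    (hΔ : 0 < Δ) (hSA : S * A = F.Atilde * S) {t : ℝ} (ht : 0 ≤ t) :
    ‖(B * K * Sinv) *ᵥ (F.E (-t) *ᵥ (xhat t - xbar F S x t))‖ ≤
      ‖B * K * Sinv‖ * Fintype.card F.Coord * ‖J t‖ := by
  rw [mul_assoc]
  refine (Matrix.linfty_opNorm_mulVec _ _).trans ?_
  gcongr
  refine (Matrix.linfty_opNorm_mulVec _ _).trans ?_
  gcongr
  · exact F.norm_E_le (-t)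
  · exact h.norm_error_le hΔ hSA ht

end IsClosedLoop

section Stability

variable {nx nu p : ℕ} {A : Matrix (Fin nx) (Fin nx) ℝ} {B : Matrix (Fin nx) (Fin nu) ℝ}
  {K : Matrix (Fin nu) (Fin nx) ℝ} {F : JordanShape p} {S : Matrix F.Coord (Fin nx) ℝ}
  {Sinv : Matrix (Fin nx) F.Coord ℝ} {Δ : ℝ}

open scoped Matrix.Norms.Operator in
theorem exists_norm_state_le (hK : IsHurwitz (A + B * K)) (hS : Sinv * S = 1)
    (hSA : S * A = F.Atilde * S) (hΔ : 0 < Δ) :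
    ∃ a > 0, ∀ δ < a, ∀ D ≥ 0, ∃ Q ≥ 0, ∀ dos bits x xhat xhatL J JL,
      IsClosedLoop A B K F S Sinv dos Δ bits x xhat xhatL J JL →
      (∀ t ≥ 0, ‖J t‖ ≤ D * ‖JL 0‖ * Real.exp (-δ * t)) →
      ∀ t ≥ 0, ‖x t‖ ≤ Q * (‖x 0‖ + ‖JL 0‖) * Real.exp (-δ * t) := by
  obtain ⟨a, C, ha, hC, hstable⟩ := hK.exists_norm_le_of_norm_perturbation_le
  refine ⟨a, ha, fun δ hδ D hD => ?_⟩
  set L := ‖B * K * Sinv‖ * Fintype.card F.Coord * D / (a - δ)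
  have hL : 0 ≤ L := div_nonneg (by positivity) (sub_nonneg.2 hδ.le)
  refine ⟨C * (1 + L), by positivity, fun dos bits x xhat xhatL J JL h hJ t ht => ?_⟩
  calc ‖x t‖ ≤ C * (‖x 0‖ + ‖B * K * Sinv‖ * Fintype.card F.Coord * (D * ‖JL 0‖) / (a - δ)) *
        Real.exp (-δ * t) := by
        refine hstable δ _ hδ x _ h.x_cont (fun t ht => h.hasDerivWithinAt_state hS ht)
          (fun t ht => (h.norm_state_perturbation_le hΔ hSA ht).trans ?_) t ht
        rw [mul_assoc _ (D * ‖JL 0‖)]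
        gcongr
        exact hJ t ht
    _ = C * (‖x 0‖ + L * ‖JL 0‖) * Real.exp (-δ * t) := by ring
    _ ≤ C * ((1 + L) * (‖x 0‖ + ‖JL 0‖)) * Real.exp (-δ * t) := by
        gcongr
        nlinarith [norm_nonneg (JL 0), mul_nonneg hL (norm_nonneg (x 0))]
    _ = C * (1 + L) * (‖x 0‖ + ‖JL 0‖) * Real.exp (-δ * t) := by ring

open scoped Matrix.Norms.Operator in
theorem exists_norm_closedLoop_le {w : Fin p → ℝ} {R : Fin p → ℕ} {η τD κ T : ℝ}
    (hK : IsHurwitz (A + B * K)) (hS : Sinv * S = 1) (hSA : S * A = F.Atilde * S) (hΔ : 0 < Δ)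
    (hκ : 0 ≤ κ) (hT : 0 ≤ T) (hρ : 0 < 1 - 1 / T - Δ / τD)
    (hR : ∀ r, 0 ≤ F.c r →
      1 / (1 - 1 / T - Δ / τD) * F.c r * Δ * Real.logb 2 (Real.exp 1) < (R r : ℝ))
    (hw : ∀ r, F.c r < w r) :
    ∃ C δ : ℝ, 0 < C ∧ 0 < δ ∧ ∀ dos : DoS, dos.FrequencyBound η τD → dos.DurationBound κ T →
      ∀ bits, FollowsBitProtocol dos Δ F.c w R bits → ∀ x xhat xhatL J JL,
      IsClosedLoop A B K F S Sinv dos Δ bits x xhat xhatL J JL → ∀ t ≥ 0,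
      ‖x t‖ ≤ C * Real.exp (-δ * t) * (‖x 0‖ + ‖JL 0‖) ∧
      ‖xhat t‖ ≤ C * Real.exp (-δ * t) * (‖x 0‖ + ‖JL 0‖) ∧
      ‖J t‖ ≤ C * Real.exp (-δ * t) * (‖x 0‖ + ‖JL 0‖) := by
  obtain ⟨a, ha, hstate⟩ := exists_norm_state_le hK hS hSA hΔ
  obtain ⟨δ, C, hδ, hδlt, hC, hgrowth⟩ :=
    exists_bitsOutweighGrowth (η := η) hΔ hκ hT hρ hR hw (lt_min ha one_pos)
  obtain ⟨hδa, hδ1⟩ := lt_min_iff.1 hδlt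
  set D := ∑ r, C / δ ^ F.n r
  have hD : 0 ≤ D := Finset.sum_nonneg fun r _ => by positivity
  obtain ⟨Q, hQ, hx⟩ := hstate δ hδa D hD
  set N := Fintype.card F.Coord * ‖S‖
  refine ⟨Q + (N * Q + D) + 1, δ, by positivity, hδ,
    fun dos hf hd bits hbits x xhat xhatL J JL h t ht => ?_⟩
  have hrange : ∀ t ≥ 0, ‖J t‖ ≤ D * ‖JL 0‖ * Real.exp (-δ * t) := fun t ht =>
    h.norm_range_le hΔ hSA hδ hδ1.le hC (hgrowth dos hf hd bits hbits) ht
  set X := ‖x 0‖ + ‖JL 0‖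
  set e := Real.exp (-δ * t)
  have hstate_t : ‖x t‖ ≤ Q * X * e := hx dos bits x xhat xhatL J JL h hrange t ht
  have hrange_t : ‖J t‖ ≤ D * X * e := (hrange t ht).trans (by
    gcongr
    exact le_add_of_nonneg_left (norm_nonneg _))
  have hpredictor_t : ‖xhat t‖ ≤ (N * Q + D) * X * e := calc
    ‖xhat t‖ ≤ N * (Q * X * e) + D * X * e := (h.norm_predictor_le hΔ hSA ht).trans (by gcongr)
    _ = (N * Q + D) * X * e := by ring
  have hNQ : 0 ≤ N * Q := by positivity
  have henlarge : ∀ q ≤ Q + (N * Q + D) + 1, q * X * e ≤ (Q + (N * Q + D) + 1) * e * X :=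
    fun q hq => by
      rw [mul_right_comm _ e]
      gcongr
  exact ⟨hstate_t.trans (henlarge _ (by linarith)), hpredictor_t.trans (henlarge _ (by linarith)),
    hrange_t.trans (henlarge _ (by linarith))⟩

end Stability

theorem norm_le_enorm2 {ι : Type} [Fintype ι] (v : ι → ℝ) : ‖v‖ ≤ enorm2 v :=
  (pi_norm_le_iff_of_nonneg (norm_nonneg _)).2 fun i => PiLp.norm_apply_le (WithLp.toLp 2 v) i

theorem enorm2_le_card_mul_norm {ι : Type} [Fintype ι] (v : ι → ℝ) :
    enorm2 v ≤ Fintype.card ι * ‖v‖ := by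
  refine le_of_sq_le_sq ?_ (by positivity)
  rw [enorm2, EuclideanSpace.norm_sq_eq]
  calc ∑ i, ‖v i‖ ^ 2 ≤ ∑ _i : ι, ‖v‖ ^ 2 := by
        gcongr with i
        exact norm_le_pi_norm v i
    _ = Fintype.card ι * ‖v‖ ^ 2 := by simp
    _ ≤ (Fintype.card ι : ℝ) ^ 2 * ‖v‖ ^ 2 := by
        gcongr
        exact_mod_cast Nat.le_self_pow two_ne_zero _
    _ = (Fintype.card ι * ‖v‖) ^ 2 := by ring

theorem enorm2_le_of_norm_le {ι ι' ι'' : Type} [Fintype ι] [Fintype ι'] [Fintype ι''] {v : ι → ℝ}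
    {v' : ι' → ℝ} {v'' : ι'' → ℝ} {m C e : ℝ} (hC : 0 ≤ C) (he : 0 ≤ e)
    (hm : (Fintype.card ι : ℝ) ≤ m) (hv : ‖v‖ ≤ C * e * (‖v'‖ + ‖v''‖)) :
    enorm2 v ≤ m * C * e * (enorm2 v' + enorm2 v'') := by
  have hm0 : 0 ≤ m := (Nat.cast_nonneg _).trans hm
  calc enorm2 v ≤ Fintype.card ι * ‖v‖ := enorm2_le_card_mul_norm v
    _ ≤ m * (C * e * (enorm2 v' + enorm2 v'')) := by
        gcongr
        refine hv.trans ?_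
        gcongr <;> exact norm_le_enorm2 _
    _ = m * C * e * (enorm2 v' + enorm2 v'') := by ring

end QuantizedDoS

end

theorem theorem3 {nx nu p : ℕ}
    (A : Matrix (Fin nx) (Fin nx) ℝ) (B : Matrix (Fin nx) (Fin nu) ℝ)
    (K : Matrix (Fin nu) (Fin nx) ℝ) (hK : QuantizedDoS.IsHurwitz (A + B * K))
    (F : QuantizedDoS.JordanShape p)
    (S : Matrix F.Coord (Fin nx) ℝ) (Sinv : Matrix (Fin nx) F.Coord ℝ)
    (hS : S * Sinv = 1) (hS' : Sinv * S = 1) (hA : S * A * Sinv = F.Atilde)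
    (Δ : ℝ) (hΔ : 0 < Δ)
    (η τD κ T : ℝ) (hη : 0 ≤ η) (hτD : 0 < τD) (hκ : 0 ≤ κ) (hT : 1 < T)
    (hDoS : 1 / T + Δ / τD < 1)
    (R : Fin p → ℕ)
    (hR : ∀ r, 0 ≤ F.c r →
      1 / (1 - 1 / T - Δ / τD) * F.c r * Δ * Real.logb 2 (Real.exp 1) < (R r : ℝ))
    (w : Fin p → ℝ) (hw : ∀ r, F.c r < w r) :
    ∃ C δ : ℝ, 0 < C ∧ 0 < δ ∧
      ∀ dos : QuantizedDoS.DoS, dos.FrequencyBound η τD → dos.DurationBound κ T →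
      ∀ bits : Fin p → ℕ → ℕ, QuantizedDoS.FollowsBitProtocol dos Δ F.c w R bits →
      ∀ (x : ℝ → Fin nx → ℝ) (xhat xhatL J JL : ℝ → F.Coord → ℝ),
        QuantizedDoS.IsClosedLoop A B K F S Sinv dos Δ bits x xhat xhatL J JL →
        ∀ t : ℝ, 0 ≤ t →
          QuantizedDoS.enorm2 (x t) ≤
            C * Real.exp (-δ * t) * (QuantizedDoS.enorm2 (x 0) + QuantizedDoS.enorm2 (JL 0)) ∧
          QuantizedDoS.enorm2 (xhat t) ≤
            C * Real.exp (-δ * t) * (QuantizedDoS.enorm2 (x 0) + QuantizedDoS.enorm2 (JL 0)) ∧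
          QuantizedDoS.enorm2 (J t) ≤
            C * Real.exp (-δ * t) * (QuantizedDoS.enorm2 (x 0) + QuantizedDoS.enorm2 (JL 0)) := by
  obtain ⟨C, δ, hC, hδ, hbound⟩ := QuantizedDoS.exists_norm_closedLoop_le (η := η) (w := w) hK hS'
    (QuantizedDoS.mul_eq_mul_of_mul_mul_eq hS' hA) hΔ hκ (zero_le_one.trans hT.le)
    (by linarith) hR hw
  have hnx : (Fintype.card (Fin nx) : ℝ) ≤ nx + Fintype.card F.Coord + 1 := by
    rw [Fintype.card_fin]
    linarith [(Nat.cast_nonneg _ : (0 : ℝ) ≤ Fintype.card F.Coord)]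
  have hcoord : (Fintype.card F.Coord : ℝ) ≤ nx + Fintype.card F.Coord + 1 := by
    linarith [(nx.cast_nonneg : (0 : ℝ) ≤ nx)]
  refine ⟨(nx + Fintype.card F.Coord + 1) * C, δ, by positivity, hδ,
    fun dos hf hd bits hbits x xhat xhatL J JL h t ht => ?_⟩
  obtain ⟨hx, hxhat, hJ⟩ := hbound dos hf hd bits hbits x xhat xhatL J JL h t ht
  exact ⟨QuantizedDoS.enorm2_le_of_norm_le hC.le (Real.exp_nonneg _) hnx hx,
    QuantizedDoS.enorm2_le_of_norm_le hC.le (Real.exp_nonneg _) hcoord hxhat,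
    QuantizedDoS.enorm2_le_of_norm_le hC.le (Real.exp_nonneg _) hcoord hJ⟩
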